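/- Corollary 4.5 (genus one top-degree terms). For a partition $\lambda\vdash d$ let $\chi^\lambda_\mu$ be the value of the irreducible character of $S_d$ attached to $\lambda$ at permutations of cycle type $\mu$, and let $p_3(\lambda)=\sum_{i\ge 1}\big((\lambda_i-i+\tfrac12)^3-(-i+\tfrac12)^3\big)$. Let $n\ge 1$ be odd and put $s=\frac{n+1}{2}$. For positive integers $\beta_1,\dots,\beta_n$ with $d=\beta_1+\dots+\beta_n$, the genus-one one-part double Hurwitz number with completed $3$-cycles is $$H^{1,(2)}_{(d),\beta}=\frac{1}{d\,\beta_1\cdots\beta_n}\sum_{\lambda\vdash d}\chi^\lambda_{(d)}\Big(\frac{p_3(\lambda)}{3!}\Big)^{s}\chi^\lambda_{\beta}.$$ Then there is a unique polynomial in $\mathbb{Q}[\beta_1,\dots,\beta_n]$ whose value is $d\,H^{1,(2)}_{(d),\beta}/s!$ at all positive integers $\beta_1,\dots,\beta_n$. For integers $b_1,\dots,b_n\ge 0$ with $b_1+\dots+b_n=\frac{n+5}{2}$, let $\langle\langle\tau_{b_1}\cdots\tau_{b_n}\rangle\rangle_1$ be the coefficient of $\beta_1^{b_1}\cdots\beta_n^{b_n}$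 in this polynomial. Then $$\langle\langle\tau_{b_1}\cdots\tau_{b_n}\rangle\rangle_1=\frac{(n+1)!}{3\cdot 2^{\frac{n+7}{2}}\,\big(\frac{n+1}{2}\big)!}\left[\frac1n\binom{\frac{n+5}{2}}{b_1,\dots,b_n}+\sum_{i=1}^n\binom{\frac{n+1}{2}}{b_1,\dots,b_{i-1},b_i-2,b_{i+1},\dots,b_n}\right],$$ where the $i$-th multinomial coefficient in the sum is $0$ if $b_i<2$. -/

import Mathlib

open scoped Nat

noncomputable section

namespace CompletedHurwitz

/-- The Young diagram of a partition `lam` of `d`: its row lengths are the parts of `lam` in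
weakly decreasing order. -/
def diagram {d : ℕ} (lam : d.Partition) : YoungDiagram :=
  YoungDiagram.ofRowLens (lam.parts.sort (· ≥ ·))
    (List.sortedGE_iff_pairwise.2 (Multiset.pairwise_sort _ _))

theorem card_diagram {d : ℕ} (lam : d.Partition) : (diagram lam).cells.card = d := by
  have key : ∀ w : List ℕ, (YoungDiagram.cellsOfRowLens w).card = w.sum := by
    intro w
    induction w with
    | nil => simp [YoungDiagram.cellsOfRowLens]
    | cons a w ih =>
      rw [YoungDiagram.cellsOfRowLens, Finset.card_union_of_disjoint, Finset.card_map, ih]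
      · simp
      · rw [Finset.disjoint_left]
        rintro ⟨i, j⟩ h1 h2
        simp at h1 h2
        grind
  change (YoungDiagram.cellsOfRowLens (lam.parts.sort (· ≥ ·))).card = d
  rw [key, ← Multiset.sum_coe, Multiset.sort_eq, lam.parts_sum]

/-- A Young tableau of shape `lam`: a filling of the cells by the elements of `Fin d`, each used
once. -/
abbrev Tableau {d : ℕ} (lam : d.Partition) : Type :=
  {c : ℕ × ℕ // c ∈ (diagram lam).cells} ≃ Fin d

/-- Some tableau of shape `lam` (all choices give isomorphic representations). -/
def someTableau {d : ℕ} (lam : d.Partition) : Tableau lam :=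
  Finset.equivFinOfCardEq (card_diagram lam)

/-- The row index of the cell of `T` that contains `x`. -/
def Tableau.row {d : ℕ} {lam : d.Partition} (T : Tableau lam) (x : Fin d) : ℕ :=
  (T.symm x).1.1

/-- The column index of the cell of `T` that contains `x`. -/
def Tableau.col {d : ℕ} {lam : d.Partition} (T : Tableau lam) (x : Fin d) : ℕ :=
  (T.symm x).1.2

/-- The group algebra `ℚ S_d`. -/
abbrev GroupAlg (d : ℕ) : Type := MonoidAlgebra ℚ (Equiv.Perm (Fin d))

/-- The row symmetrizer: the sum of all permutations that preserve every row of `T`. -/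
def rowSymmetrizer {d : ℕ} {lam : d.Partition} (T : Tableau lam) : GroupAlg d :=
  ∑ p : Equiv.Perm (Fin d) with ∀ x, Tableau.row T (p x) = Tableau.row T x,
    MonoidAlgebra.of ℚ (Equiv.Perm (Fin d)) p

/-- The column antisymmetrizer: the signed sum of all permutations that preserve every column
of `T`. -/
def colAntisymmetrizer {d : ℕ} {lam : d.Partition} (T : Tableau lam) : GroupAlg d :=
  ∑ q : Equiv.Perm (Fin d) with ∀ x, Tableau.col T (q x) = Tableau.col T x,
    ((Equiv.Perm.sign q : ℤ) : ℚ) • MonoidAlgebra.of ℚ (Equiv.Perm (Fin d)) q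

/-- The Young symmetrizer of a tableau. -/
def youngSymmetrizer {d : ℕ} {lam : d.Partition} (T : Tableau lam) : GroupAlg d :=
  rowSymmetrizer T * colAntisymmetrizer T

/-- The irreducible representation of `S_d` attached to `lam`: the left ideal of `ℚ S_d` generated
by a Young symmetrizer of shape `lam`. -/
abbrev SpechtModule {d : ℕ} (lam : d.Partition) : Ideal (GroupAlg d) :=
  Ideal.span {youngSymmetrizer (someTableau lam)}

/-- The irreducible character of `S_d` attached to `lam`: the trace of the action of a permutation
on the irreducible representation. -/
def irrChar {d : ℕ} (lam : d.Partition) (σ : Equiv.Perm (Fin d)) : ℚ :=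
  LinearMap.trace ℚ (SpechtModule lam)
    (Algebra.lsmul ℚ ℚ (SpechtModule lam) (MonoidAlgebra.of ℚ (Equiv.Perm (Fin d)) σ))

/-- For every partition `mu` of `d` there is a permutation of `Fin d` whose cycle lengths, fixed
points included, are the parts of `mu`. -/
theorem exists_perm {d : ℕ} (mu : d.Partition) :
    ∃ σ : Equiv.Perm (Fin d), σ.partition.parts = mu.parts := by
  have hsplit : mu.parts.filter (2 ≤ ·) + Multiset.replicate (mu.parts.count 1) 1 = mu.parts := by
    rw [← Multiset.filter_eq']
    conv_rhs => rw [← Multiset.filter_add_not (fun a => 2 ≤ a) mu.parts]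
    congr 1
    refine Multiset.filter_congr fun a ha => ?_
    have := mu.parts_pos ha
    omega
  have hsum := congrArg Multiset.sum hsplit
  rw [mu.parts_sum, Multiset.sum_add, Multiset.sum_replicate, smul_eq_mul, mul_one] at hsum
  obtain ⟨σ, hσ⟩ := (Equiv.Perm.exists_with_cycleType_iff (Fin d)
    (m := mu.parts.filter (2 ≤ ·))).2 ⟨by rw [Fintype.card_fin]; omega,
      fun a ha => (Multiset.mem_filter.1 ha).2⟩
  refine ⟨σ, ?_⟩
  rw [Equiv.Perm.parts_partition, ← Equiv.Perm.sum_cycleType, hσ, Fintype.card_fin]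
  conv_rhs => rw [← hsplit]
  congr 2
  omega

/-- `χ^lam_mu`: the value of the irreducible character attached to `lam` at a permutation of cycle
type `mu`. -/
def chi {d : ℕ} (lam mu : d.Partition) : ℚ :=
  irrChar lam (exists_perm mu).choose

/-- The shifted symmetric power sum
`p_k(lam) = ∑_{i ≥ 1} ((lam_i - i + 1/2)^k - (-i + 1/2)^k)`; here rows are numbered from `0`, and
the terms beyond the last row vanish. -/
def shiftedPowerSum {d : ℕ} (k : ℕ) (lam : d.Partition) : ℚ :=
  ∑ i ∈ Finset.range ((diagram lam).colLen 0),
    ((((diagram lam).rowLen i : ℚ) - ((i : ℚ) + 1) + 1 / 2) ^ k - (-((i : ℚ) + 1) + 1 / 2) ^ k)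

/-- The number `s` of completed `(r+1)`-cycles, determined by `r s = 2 g - 2 + l(al) + l(be)`
(meaningful when `r` divides the right-hand side). -/
def numCycles {d : ℕ} (g r : ℕ) (al be : d.Partition) : ℕ :=
  (2 * g + al.parts.card + be.parts.card - 2) / r

/-- The disconnected double Hurwitz number `H^{g,(r)}_{al,be}` with completed `(r+1)`-cycles. -/
def hurwitz {d : ℕ} (g r : ℕ) (al be : d.Partition) : ℚ :=
  1 / ((al.parts.prod : ℚ) * (be.parts.prod : ℚ)) *
    ∑ lam : d.Partition,
      chi lam al * (shiftedPowerSum (r + 1) lam / ((r + 1)! : ℚ)) ^ numCycles g r al be *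
        chi lam be

/-- The partition of `β_1 + ⋯ + β_n` with parts `β_1, …, β_n` (used for positive `β_i`). -/
def partitionOf {n : ℕ} (β : Fin n → ℕ) : (∑ i, β i).Partition :=
  Nat.Partition.ofSums _ (Finset.univ.val.map β) rfl

/-- The one-part double Hurwitz number with completed `3`-cycles `H^{g,(2)}_{(d),β}`, where
`d = β_1 + ⋯ + β_n`. -/
def onePartHurwitz (g : ℕ) {n : ℕ} (β : Fin n → ℕ) : ℚ :=
  hurwitz g 2 (Nat.Partition.indiscrete (∑ i, β i)) (partitionOf β)

/-- `P` is a polynomial expression of `d H^{g,(2)}_{(d),β} / s!`, `s = g + (n - 1) / 2`, in the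
parts `β_1, …, β_n` (`n` odd). -/
def IsHurwitzPolynomial (g : ℕ) {n : ℕ} (P : MvPolynomial (Fin n) ℚ) : Prop :=
  ∀ β : Fin n → ℕ, (∀ i, 0 < β i) →
    MvPolynomial.eval (fun i => (β i : ℚ)) P =
      ((∑ i, β i : ℕ) : ℚ) * onePartHurwitz g β / ((g + (n - 1) / 2)! : ℚ)

open Classical in
/-- The polynomial `d H^{g,(2)}_{(d),β} / s!` in `β_1, …, β_n`. -/
def hurwitzPolynomial (g n : ℕ) : MvPolynomial (Fin n) ℚ :=
  if h : ∃ P : MvPolynomial (Fin n) ℚ, IsHurwitzPolynomial g P then h.choose else 0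

/-- The combinatorial Hodge integral `⟨⟨τ_{b_1} ⋯ τ_{b_n} Λ_{2k}⟩⟩_g` for `n` odd; it vanishes
unless `b_1 + ⋯ + b_n + 2 k = 3 g + (n - 1) / 2`. -/
def combHodge (g k : ℕ) {n : ℕ} (b : Fin n → ℕ) : ℚ :=
  if ∑ i, b i + 2 * k = 3 * g + (n - 1) / 2 then
    (-1) ^ k * (hurwitzPolynomial g n).coeff (Finsupp.equivFunOnFinite.symm b)
  else 0

/-- The top degree term `⟨⟨τ_{b_1} ⋯ τ_{b_n}⟩⟩_g`. -/
def topTerm (g : ℕ) {n : ℕ} (b : Fin n → ℕ) : ℚ :=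
  combHodge g 0 b

end CompletedHurwitz

end

/-! Write `n = 2t + 1`, so that `s = t + 1`. The sum over `λ` collapses to hooks: at a `d`-cycle the
character vanishes unless `λ` is a hook, and on the hook with leg `k` it equals `(-1)^k`. On that
hook `p_3 / 3! = d^3/24 + (d/2) x^2` with the centred coordinate `x = (d-1)/2 - k`. Hence `d ∏ β_i`
times the Hurwitz number is the integral of `(d^3/24 + (d/2) x^2)^(t+1)` against the signed measure
with mass `v_k = (-1)^k χ^{hook k}_β` at `x`.

The hook characters satisfy `(1 - X) ∑ v_k X^k = ∏ (1 - X^{β_i})` (`one_sub_X_mul_sum_hookChar`).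
Substituting `X = exp(-u)` and centring turns the moment generating function into `∏ 2 sinh(β_i u/2)
/ (2 sinh(u/2))`. It vanishes to order `2t` at `u = 0`, so only the two highest powers of `x`
contribute, and their moments come from the first terms of the sinh series
(`moments_of_generating_function`). The factor `∏ β_i` cancels, leaving a polynomial with components
of degree `t + 3` and `t + 1` only; its top coefficients are multinomial. Uniqueness holds because
positive integer points are Zariski dense.

The character theory is done inside the group algebra. The character of a left ideal generated by an
idempotent `e` is a sum of coefficients of `e` over a conjugacy class (`trace_lsmul_eq_conjTrace`).
Hook symmetrizers are explicit quasi-idempotents (`hookElement_sq`), and two adjacent hooks add up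
to an exterior power of the permutation representation (`sum_conjTrace_hookElement`), which gives
the generating function. For a non-hook shape, the Young symmetrizer annihilates all hook elements.
Since the alternating sum of hook characters is `d` times the indicator of the `d`-cycles, the
resulting orthogonality forces the non-hook character to vanish there
(`irrChar_long_cycle_eq_zero`). -/

noncomputable section

namespace CompletedHurwitz

section Characters

open Equiv MonoidAlgebra

/-! ### Symmetrizers and antisymmetrizers in the group algebra. -/

section GroupAlgebra

variable {d : ℕ}

/-- The sign character with rational values. -/
def signQ (d : ℕ) : Perm (Fin d) →* ℚ :=
  ((Int.castRingHom ℚ).toMonoidHom.comp (Units.coeHom ℤ)).comp Perm.sign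

@[simp] lemma signQ_apply (p : Perm (Fin d)) : signQ d p = ((Perm.sign p : ℤ) : ℚ) := rfl

/-- The permutations that fix every point outside `X`. -/
def permsOn (X : Finset (Fin d)) : Finset (Perm (Fin d)) := {p | ∀ x, x ∉ X → p x = x}

lemma mem_permsOn {X : Finset (Fin d)} {p : Perm (Fin d)} :
    p ∈ permsOn X ↔ ∀ x, x ∉ X → p x = x := by simp [permsOn]

lemma apply_mem_of_mem_permsOn {X : Finset (Fin d)} {p : Perm (Fin d)} (hp : p ∈ permsOn X)
    {x : Fin d} : p x ∈ X ↔ x ∈ X := by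
  rw [mem_permsOn] at hp
  by_cases hx : x ∈ X
  · simp only [hx, iff_true]
    by_contra h
    have := hp _ h
    exact h ((p.injective this).symm ▸ hx)
  · simp [hp x hx]

lemma mul_mem_permsOn {X : Finset (Fin d)} {p q : Perm (Fin d)} (hp : p ∈ permsOn X)
    (hq : q ∈ permsOn X) : p * q ∈ permsOn X := by
  rw [mem_permsOn] at *
  intro x hx
  simp [hq x hx, hp x hx]

lemma inv_mem_permsOn {X : Finset (Fin d)} {p : Perm (Fin d)} (hp : p ∈ permsOn X) :
    p⁻¹ ∈ permsOn X := by
  rw [mem_permsOn] at *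
  intro x hx
  rw [Perm.inv_eq_iff_eq, hp x hx]

lemma swap_mem_permsOn {X : Finset (Fin d)} {x y : Fin d} (hx : x ∈ X) (hy : y ∈ X) :
    swap x y ∈ permsOn X := by
  rw [mem_permsOn]
  intro z hz
  exact swap_apply_of_ne_of_ne (fun h => hz (h ▸ hx)) (fun h => hz (h ▸ hy))

lemma card_permsOn (X : Finset (Fin d)) : (permsOn X).card = X.card ! := by
  have h := Fintype.card_congr (Perm.subtypeEquivSubtypePerm (fun x => x ∈ X))
  rw [Fintype.card_perm, Fintype.card_coe] at h
  rw [h, Fintype.card_subtype]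
  rfl

/-- The sum of the permutations of `X`, weighted by the character `ε`. -/
def twistedSum (ε : Perm (Fin d) →* ℚ) (X : Finset (Fin d)) : GroupAlg d :=
  ∑ p ∈ permsOn X, ε p • of ℚ (Perm (Fin d)) p

lemma of_mul_twistedSum (ε : Perm (Fin d) →* ℚ) {X : Finset (Fin d)} {p : Perm (Fin d)}
    (hp : p ∈ permsOn X) :
    of ℚ (Perm (Fin d)) p * twistedSum ε X = ε p⁻¹ • twistedSum ε X := by
  rw [twistedSum, Finset.mul_sum, Finset.smul_sum]
  refine Finset.sum_nbij' (fun q => p * q) (fun q => p⁻¹ * q)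
    (fun q hq => mul_mem_permsOn hp hq) (fun q hq => mul_mem_permsOn (inv_mem_permsOn hp) hq)
    (by simp) (by simp) ?_
  intro q _
  rw [mul_smul_comm, ← map_mul, smul_smul, ← map_mul]
  simp

lemma twistedSum_mul_of (ε : Perm (Fin d) →* ℚ) {X : Finset (Fin d)} {p : Perm (Fin d)}
    (hp : p ∈ permsOn X) :
    twistedSum ε X * of ℚ (Perm (Fin d)) p = ε p⁻¹ • twistedSum ε X := by
  rw [twistedSum, Finset.sum_mul, Finset.smul_sum]
  refine Finset.sum_nbij' (fun q => q * p) (fun q => q * p⁻¹)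
    (fun q hq => mul_mem_permsOn hq hp) (fun q hq => mul_mem_permsOn hq (inv_mem_permsOn hp))
    (by simp) (by simp) ?_
  intro q _
  rw [smul_mul_assoc, ← map_mul, smul_smul, mul_comm (ε _), ← map_mul]
  simp

lemma twistedSum_mul_self (ε : Perm (Fin d) →* ℚ) (X : Finset (Fin d)) :
    twistedSum ε X * twistedSum ε X = (X.card ! : ℚ) • twistedSum ε X := by
  conv_lhs => enter [1]; rw [twistedSum]
  rw [Finset.sum_mul]
  have : ∀ p ∈ permsOn X,
      (ε p • of ℚ (Perm (Fin d)) p) * twistedSum ε X = twistedSum ε X := by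
    intro p hp
    rw [smul_mul_assoc, of_mul_twistedSum ε hp, smul_smul, ← map_mul]
    simp
  rw [Finset.sum_congr rfl this, Finset.sum_const, card_permsOn, Nat.cast_smul_eq_nsmul]

/-- Coset decomposition: a permutation `p` of `X ∪ {y}` factors uniquely as `q * swap (p⁻¹ y) y`
with `q` fixing `y`. The summand `1` is the degenerate transposition `swap y y`. -/
lemma twistedSum_insert (ε : Perm (Fin d) →* ℚ) {X : Finset (Fin d)} {y : Fin d} (hy : y ∉ X) :
    twistedSum ε (insert y X) = twistedSum ε X *
      (1 + ∑ x ∈ X, ε (swap x y) • of ℚ (Perm (Fin d)) (swap x y)) := by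
  have h1 : (1 + ∑ x ∈ X, ε (swap x y) • of ℚ (Perm (Fin d)) (swap x y)) =
      ∑ x ∈ insert y X, ε (swap x y) • of ℚ (Perm (Fin d)) (swap x y) := by
    rw [Finset.sum_insert hy]
    simp [← Perm.one_def, MonoidAlgebra.one_def]
  rw [h1, twistedSum, twistedSum, Finset.sum_mul_sum, ← Finset.sum_product']
  refine Finset.sum_nbij' (fun p => (p * swap (p⁻¹ y) y, p⁻¹ y)) (fun q => q.1 * swap q.2 y)
    ?_ ?_ ?_ ?_ ?_
  · intro p hp
    rw [Finset.mem_product]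
    have hpy : p⁻¹ y ∈ insert y X :=
      (apply_mem_of_mem_permsOn (inv_mem_permsOn hp)).2 (Finset.mem_insert_self y X)
    refine ⟨mem_permsOn.2 fun x hx => ?_, hpy⟩
    by_cases hxy : x = y
    · subst hxy; simp
    · have hx' : x ∉ insert y X := by simp [hx, hxy]
      have : x ≠ p⁻¹ y := fun h => hx' (h ▸ hpy)
      simp only [Perm.mul_apply]
      rw [swap_apply_of_ne_of_ne this hxy]
      exact mem_permsOn.1 hp x hx'
  · rintro ⟨q, x⟩ hq
    rw [Finset.mem_product] at hq
    refine mul_mem_permsOn (mem_permsOn.2 fun z hz => ?_)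
      (swap_mem_permsOn hq.2 (Finset.mem_insert_self y X))
    exact mem_permsOn.1 hq.1 z fun h => hz (Finset.mem_insert_of_mem h)
  · intro p _
    simp [mul_assoc]
  · rintro ⟨q, x⟩ hq
    rw [Finset.mem_product] at hq
    have hqy : q⁻¹ y = y := mem_permsOn.1 (inv_mem_permsOn hq.1) y hy
    have : (q * swap x y)⁻¹ y = x := by
      rw [mul_inv_rev, Perm.mul_apply, hqy, swap_inv, swap_apply_right]
    simp only [this, Prod.mk.injEq, and_true]
    simp [mul_assoc]
  · intro p _
    rw [smul_mul_smul_comm, ← map_mul, ← map_mul]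
    simp [mul_assoc]

lemma twistedSum_conj (ε : Perm (Fin d) →* ℚ) (X : Finset (Fin d)) (g : Perm (Fin d)) :
    of ℚ (Perm (Fin d)) g * twistedSum ε X * of ℚ (Perm (Fin d)) g⁻¹ =
      twistedSum ε (X.map g.toEmbedding) := by
  rw [twistedSum, twistedSum, Finset.mul_sum, Finset.sum_mul]
  refine Finset.sum_nbij' (fun p => g * p * g⁻¹) (fun p => g⁻¹ * p * g) ?_ ?_ ?_ ?_ ?_
  · intro p hp
    rw [mem_permsOn] at hp ⊢
    intro x hx
    have : g⁻¹ x ∉ X := fun h => hx (Finset.mem_map.2 ⟨_, h, by simp⟩)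
    rw [Perm.mul_apply, Perm.mul_apply, hp _ this]
    simp
  · intro p hp
    rw [mem_permsOn] at hp ⊢
    intro x hx
    have : g x ∉ X.map g.toEmbedding := by simpa using hx
    simp [hp _ this]
  · intro p _
    simp [mul_assoc]
  · intro p _
    simp [mul_assoc]
  · intro p _
    rw [mul_smul_comm, smul_mul_assoc, ← map_mul, ← map_mul]
    congr 1
    rw [map_mul, map_mul, mul_comm, ← mul_assoc, ← map_mul]
    simp

lemma commute_twistedSum (ε δ : Perm (Fin d) →* ℚ) {X Y : Finset (Fin d)} (h : Disjoint X Y) :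
    Commute (twistedSum ε X) (twistedSum δ Y) := by
  refine Commute.sum_left _ _ _ fun p hp => Commute.sum_right _ _ _ fun q hq => ?_
  refine ((Commute.map ?_ (of ℚ (Perm (Fin d)))).smul_left _).smul_right _
  refine Perm.Disjoint.commute fun x => ?_
  by_cases hx : x ∈ X
  · exact Or.inr (mem_permsOn.1 hq x (Finset.disjoint_left.1 h hx))
  · exact Or.inl (mem_permsOn.1 hp x hx)

lemma eq_zero_of_eq_neg_self {x : GroupAlg d} (h : x = -x) : x = 0 := by
  have h4 : (2 : ℚ) • x = 0 := by
    rw [two_smul]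
    exact eq_neg_iff_add_eq_zero.1 h
  exact (smul_eq_zero.1 h4).resolve_left two_ne_zero

/-- A symmetrizer and an antisymmetrizer that share a transposition annihilate each other. -/
lemma twistedSum_mul_twistedSum_eq_zero {X Y : Finset (Fin d)} {x y : Fin d} (hxy : x ≠ y)
    (hxX : x ∈ X) (hyX : y ∈ X) (hxY : x ∈ Y) (hyY : y ∈ Y) :
    twistedSum 1 X * twistedSum (signQ d) Y = 0 := by
  have h1 : twistedSum 1 X * of ℚ (Perm (Fin d)) (swap x y) = twistedSum 1 X := by
    rw [twistedSum_mul_of _ (swap_mem_permsOn hxX hyX)]; simp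
  have h2 : of ℚ (Perm (Fin d)) (swap x y) * twistedSum (signQ d) Y =
      -twistedSum (signQ d) Y := by
    rw [of_mul_twistedSum _ (swap_mem_permsOn hxY hyY)]; simp [Perm.sign_swap hxy]
  have h3 : twistedSum 1 X * twistedSum (signQ d) Y =
      -(twistedSum 1 X * twistedSum (signQ d) Y) := by
    conv_lhs => rw [← h1, mul_assoc, h2, mul_neg]
  exact eq_zero_of_eq_neg_self h3

end GroupAlgebra

/-! ### Characters of left ideals as class sums of coefficients. -/

section Trace

variable {d : ℕ}

/-- The sum of the coefficients of `x` over the conjugates of `σ⁻¹`, one for each conjugating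
element; this is the trace of `y ↦ σ * y * x`. -/
def conjTrace (σ : Perm (Fin d)) : GroupAlg d →ₗ[ℚ] ℚ where
  toFun x := ∑ g, x.coeff (g⁻¹ * σ⁻¹ * g)
  map_add' x y := by simp [Finset.sum_add_distrib]
  map_smul' c x := by simp [Finset.mul_sum]

lemma conjTrace_apply (σ : Perm (Fin d)) (x : GroupAlg d) :
    conjTrace σ x = ∑ g, x.coeff (g⁻¹ * σ⁻¹ * g) := rfl

lemma conjTrace_conj (σ τ : Perm (Fin d)) (x : GroupAlg d) :
    conjTrace (τ * σ * τ⁻¹) x = conjTrace σ x := by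
  rw [conjTrace_apply, conjTrace_apply]
  refine Fintype.sum_equiv (Equiv.mulLeft τ⁻¹) _ _ fun g => ?_
  simp [mul_assoc]

lemma conjTrace_of_mul (σ u : Perm (Fin d)) (x : GroupAlg d) :
    conjTrace σ (of ℚ _ u * x) = conjTrace σ (x * of ℚ _ u) := by
  rw [conjTrace_apply, conjTrace_apply]
  refine Fintype.sum_equiv (Equiv.mulRight u) _ _ fun g => ?_
  simp [mul_assoc]

lemma groupAlg_eq_sum (x : GroupAlg d) : x = ∑ g, x.coeff g • of ℚ _ g := by
  ext g
  simp

lemma conjTrace_mul_comm (σ : Perm (Fin d)) (x y : GroupAlg d) :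
    conjTrace σ (x * y) = conjTrace σ (y * x) := by
  rw [groupAlg_eq_sum x, Finset.sum_mul, Finset.mul_sum, map_sum, map_sum]
  refine Finset.sum_congr rfl fun g _ => ?_
  rw [smul_mul_assoc, mul_smul_comm, map_smul, map_smul, conjTrace_of_mul]

lemma conjTrace_eq_sum_coeff (σ : Perm (Fin d)) (x : GroupAlg d) :
    conjTrace σ x = ∑ g, (of ℚ _ σ * (of ℚ _ g * x)).coeff g := by
  rw [conjTrace_apply]
  refine Finset.sum_congr rfl fun g _ => ?_
  simp [mul_assoc]

/-- The character of a left ideal generated by an idempotent. -/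
lemma trace_lsmul_eq_conjTrace (I : Ideal (GroupAlg d)) {e : GroupAlg d} (he : e ∈ I)
    (hI : ∀ x ∈ I, x * e = x) (σ : Perm (Fin d)) :
    LinearMap.trace ℚ I (Algebra.lsmul ℚ ℚ I (of ℚ (Perm (Fin d)) σ)) = conjTrace σ e := by
  let ι : I →ₗ[ℚ] GroupAlg d := (Submodule.subtype I).restrictScalars ℚ
  let f : GroupAlg d →ₗ[ℚ] I :=
    { toFun := fun x => ⟨x * e, I.mul_mem_left x he⟩
      map_add' := fun x y => by ext1; exact add_mul x y e
      map_smul' := fun c x => by ext1; exact smul_mul_assoc c x e }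
  let L : GroupAlg d →ₗ[ℚ] GroupAlg d := LinearMap.mulLeft ℚ (of ℚ (Perm (Fin d)) σ)
  -- Right multiplication by `e` projects onto `I`, so by cyclicity the trace on `I` is that of `y ↦
  -- σ * y * e` on the whole group algebra.
  have h1 : Algebra.lsmul ℚ ℚ I (of ℚ (Perm (Fin d)) σ) = f ∘ₗ (L ∘ₗ ι) := by
    ext1 x
    ext1
    change of ℚ (Perm (Fin d)) σ * (x : GroupAlg d) = of ℚ (Perm (Fin d)) σ * (x : GroupAlg d) * e
    rw [mul_assoc, hI x x.2]
  rw [h1, LinearMap.trace_comp_comm', LinearMap.trace_eq_matrix_trace ℚ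
    (MonoidAlgebra.basis (Perm (Fin d)) ℚ), Matrix.trace, conjTrace_eq_sum_coeff]
  refine Finset.sum_congr rfl fun g _ => ?_
  rw [Matrix.diag_apply, LinearMap.toMatrix_apply]
  rfl

/-- Dividing the Young symmetrizer by `m` yields an idempotent generator of the same ideal. -/
lemma irrChar_eq_conjTrace_of_sq {lam : d.Partition} {m : ℚ} (hm : m ≠ 0)
    (h : youngSymmetrizer (someTableau lam) * youngSymmetrizer (someTableau lam) =
      m • youngSymmetrizer (someTableau lam)) (σ : Perm (Fin d)) :
    irrChar lam σ = m⁻¹ * conjTrace σ (youngSymmetrizer (someTableau lam)) := by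
  rw [← smul_eq_mul, ← map_smul]
  refine trace_lsmul_eq_conjTrace _ ?_ ?_ σ
  · rw [← smul_one_mul]
    exact Ideal.mul_mem_left _ _ (Ideal.subset_span rfl)
  · intro x hx
    obtain ⟨y, rfl⟩ := Ideal.mem_span_singleton'.1 hx
    rw [mul_assoc, mul_smul_comm, h, smul_smul, inv_mul_cancel₀ hm, one_smul]

/-- Semisimplicity supplies an idempotent generator for every shape. It is kept as a left multiple
of the Young symmetrizer, because the annihilation arguments use only that factor. -/
lemma exists_irrChar_eq_conjTrace (lam : d.Partition) :
    ∃ x : GroupAlg d, ∀ σ : Perm (Fin d),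
      irrChar lam σ = conjTrace σ (x * youngSymmetrizer (someTableau lam)) := by
  obtain ⟨e, he, hI⟩ := IsSemisimpleRing.ideal_eq_span_idempotent (SpechtModule lam)
  have hmem : e ∈ SpechtModule lam := hI ▸ Ideal.subset_span rfl
  obtain ⟨x, hx⟩ := Ideal.mem_span_singleton'.1 hmem
  refine ⟨x, fun σ => ?_⟩
  rw [hx]
  refine trace_lsmul_eq_conjTrace _ hmem (fun y hy => ?_) σ
  rw [hI] at hy
  obtain ⟨z, rfl⟩ := Ideal.mem_span_singleton'.1 hy
  rw [mul_assoc, he.eq]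

lemma irrChar_conj (lam : d.Partition) (σ τ : Perm (Fin d)) :
    irrChar lam (τ * σ * τ⁻¹) = irrChar lam σ := by
  obtain ⟨x, hx⟩ := exists_irrChar_eq_conjTrace lam
  rw [hx, hx, conjTrace_conj]

end Trace

/-! ### Young symmetrizers of hook shape are quasi-idempotent. -/

section Hook

variable {d : ℕ}

/-- The product of the symmetrizer of the complement of `Z` and the antisymmetrizer of `Z ∪ {o}`:
for `o ∉ Z` this is a Young symmetrizer of hook shape. -/
def hookElement (Z : Finset (Fin d)) (o : Fin d) : GroupAlg d :=
  twistedSum 1 Zᶜ * twistedSum (signQ d) (insert o Z)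

/-- Evaluate the product of the symmetrizers of `X ∪ {y}` and `X` twice: by absorption, and by coset
expansion. In the expansion all `swap x y` contribute equally, being conjugate under permutations
that the symmetrizer of `X` absorbs. -/
lemma twistedSum_one_mul_swap_mul {X : Finset (Fin d)} {o y : Fin d} (ho : o ∈ X) (hy : y ∉ X) :
    twistedSum 1 X * of ℚ _ (swap o y) * twistedSum 1 X =
      ((X.card - 1)! : ℚ) • (twistedSum 1 (insert y X) - twistedSum 1 X) := by
  have hswap : ∀ x ∈ X, twistedSum 1 X * of ℚ _ (swap x y) * twistedSum 1 X =
      twistedSum 1 X * of ℚ _ (swap o y) * twistedSum 1 X := by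
    intro x hx
    by_cases hxo : x = o
    · rw [hxo]
    have hyx : y ≠ x := fun h => hy (h ▸ hx)
    have hyo : y ≠ o := fun h => hy (h ▸ ho)
    have h1 : swap x y = swap o x * swap o y * swap o x := by
      have := swap_mul_swap_mul_swap (x := y) (y := o) (z := x) hyo hyx
      rw [swap_comm o y, this]
    have h2 : swap o x ∈ permsOn X := swap_mem_permsOn ho hx
    rw [h1, map_mul, map_mul]
    have h3 : twistedSum 1 X * (of ℚ _ (swap o x) * of ℚ _ (swap o y) * of ℚ _ (swap o x)) *
        twistedSum 1 X = (twistedSum 1 X * of ℚ _ (swap o x)) * of ℚ _ (swap o y) *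
          (of ℚ _ (swap o x) * twistedSum 1 X) := by simp only [mul_assoc]
    rw [h3, twistedSum_mul_of _ h2, of_mul_twistedSum _ h2]
    simp
  have hsub : ∀ p ∈ permsOn X, p ∈ permsOn (insert y X) := fun p hp => mem_permsOn.2 fun z hz =>
    mem_permsOn.1 hp z fun h => hz (Finset.mem_insert_of_mem h)
  have hL : twistedSum 1 (insert y X) * twistedSum 1 X =
      (X.card ! : ℚ) • twistedSum 1 (insert y X) := by
    conv_lhs => enter [2]; rw [twistedSum]
    rw [Finset.mul_sum, Finset.sum_congr rfl fun p hp => by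
      rw [mul_smul_comm, twistedSum_mul_of _ (hsub p hp)]]
    simp [card_permsOn, Nat.cast_smul_eq_nsmul]
  have hR : twistedSum 1 (insert y X) * twistedSum 1 X = (X.card ! : ℚ) • twistedSum 1 X +
      (X.card : ℚ) • (twistedSum 1 X * of ℚ _ (swap o y) * twistedSum 1 X) := by
    rw [twistedSum_insert _ hy, mul_add, mul_one, add_mul, twistedSum_mul_self, Finset.mul_sum,
      Finset.sum_mul]
    congr 1
    rw [Finset.sum_congr rfl (g := fun _ => twistedSum 1 X * of ℚ _ (swap o y) * twistedSum 1 X),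
      Finset.sum_const, Nat.cast_smul_eq_nsmul]
    intro x hx
    rw [← hswap x hx]
    simp
  have hc : 0 < X.card := Finset.card_pos.2 ⟨o, ho⟩
  have hc' : (X.card : ℚ) ≠ 0 := by positivity
  have hf : (X.card ! : ℚ) = X.card * (X.card - 1)! := by
    rw [← Nat.cast_mul, Nat.mul_factorial_pred hc.ne']
  rw [hL, hf, mul_smul, mul_smul, ← smul_add] at hR
  have := smul_right_injective _ hc' hR
  rw [smul_sub, this, add_sub_cancel_left]

/-- Conjugation by a permutation of `X` permutes the transpositions `swap x y` (a Jucys–Murphy type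
element). -/
lemma commute_twistedSum_sum_swap (ε : Perm (Fin d) →* ℚ) {X : Finset (Fin d)} {y : Fin d}
    (hy : y ∉ X) : Commute (twistedSum ε X) (∑ x ∈ X, of ℚ (Perm (Fin d)) (swap x y)) := by
  refine Commute.sum_left _ _ _ fun p hp => Commute.smul_left ?_ _
  rw [Commute, SemiconjBy, Finset.mul_sum, Finset.sum_mul]
  refine Finset.sum_nbij' (fun x => p x) (fun x => p⁻¹ x)
    (fun x hx => (apply_mem_of_mem_permsOn hp).2 hx)
    (fun x hx => (apply_mem_of_mem_permsOn (inv_mem_permsOn hp)).2 hx) (by simp) (by simp) ?_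
  intro x _
  rw [← map_mul, ← map_mul, mul_swap_eq_swap_mul, mem_permsOn.1 hp y hy]

/-- Let `J` be the sum of the `swap y o` over `y ∈ Z`, so `b = (1 - J) b'`. As `b'` commutes with
`a`, the square is `a (1 - J) a b' b` with `b' b = |Z|! b`. In each `a * swap y o * a * b` the
larger symmetrizer shares the transposition `(o y)` with `b` and dies, leaving a multiple of `a b`.
The constant, `|Z|!` times `|Zᶜ|! + |Z| (|Zᶜ| - 1)!`, is the product of the hook lengths. -/
lemma hookElement_sq {Z : Finset (Fin d)} {o : Fin d} (ho : o ∉ Z) :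
    hookElement Z o * hookElement Z o =
      ((d : ℚ) * (d - 1 - Z.card)! * Z.card !) • hookElement Z o := by
  have hoX : o ∈ Zᶜ := by simpa using ho
  set a := twistedSum 1 Zᶜ with ha
  set b := twistedSum (signQ d) (insert o Z) with hb
  set b' := twistedSum (signQ d) Z with hb'
  have hcomm : Commute a b' := commute_twistedSum _ _ disjoint_compl_left
  have hswap : ∀ y ∈ Z, a * of ℚ _ (swap y o) * a * b = -((Zᶜ.card - 1)! : ℚ) • (a * b) := by
    intro y hy
    have hoy : o ≠ y := fun h => ho (h ▸ hy)
    rw [swap_comm, twistedSum_one_mul_swap_mul hoX (by simpa using hy), smul_mul_assoc, sub_mul,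
      twistedSum_mul_twistedSum_eq_zero hoy (Finset.mem_insert_of_mem hoX)
        (Finset.mem_insert_self _ _) (Finset.mem_insert_self _ _) (Finset.mem_insert_of_mem hy)]
    simp
    rfl
  have hbb : b' * b = (Z.card ! : ℚ) • b := by
    have hsub : ∀ p ∈ permsOn Z, p ∈ permsOn (insert o Z) := fun p hp => mem_permsOn.2 fun z hz =>
      mem_permsOn.1 hp z fun h => hz (Finset.mem_insert_of_mem h)
    rw [hb', twistedSum, Finset.sum_mul, Finset.sum_congr rfl fun p hp => by
      rw [smul_mul_assoc, of_mul_twistedSum _ (hsub p hp), smul_smul, ← map_mul]]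
    simp [card_permsOn, Nat.cast_smul_eq_nsmul]
    rfl
  have hu : b = b' * (1 - ∑ y ∈ Z, of ℚ _ (swap y o)) := by
    rw [hb, twistedSum_insert _ ho, sub_eq_add_neg, ← Finset.sum_neg_distrib]
    congr 2
    refine Finset.sum_congr rfl fun y hy => ?_
    have : y ≠ o := fun h => ho (h ▸ hy)
    simp [Perm.sign_swap this]
  have hu' : b = (1 - ∑ y ∈ Z, of ℚ _ (swap y o)) * b' := by
    rw [hu]
    exact ((Commute.one_right _).sub_right (commute_twistedSum_sum_swap _ ho)).eq
  have hcard : Zᶜ.card = d - Z.card := by rw [Finset.card_compl, Fintype.card_fin]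
  have hpos : 0 < Zᶜ.card := Finset.card_pos.2 ⟨o, hoX⟩
  have hd : (d : ℚ) = Zᶜ.card + Z.card := by
    rw [← Nat.cast_add, Finset.card_compl_add_card, Fintype.card_fin]
  have hf : (Zᶜ.card ! : ℚ) = Zᶜ.card * (Zᶜ.card - 1)! := by
    rw [← Nat.cast_mul, Nat.mul_factorial_pred hpos.ne']
  have hfd : d - 1 - Z.card = Zᶜ.card - 1 := by omega
  change a * b * (a * b) = _ • (a * b)
  calc a * b * (a * b) = a * ((1 - ∑ y ∈ Z, of ℚ _ (swap y o)) * b') * (a * b) := by rw [← hu']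
    _ = (a * (1 - ∑ y ∈ Z, of ℚ _ (swap y o))) * (b' * a) * b := by simp only [mul_assoc]
    _ = (a * (1 - ∑ y ∈ Z, of ℚ _ (swap y o))) * a * (b' * b) := by
      rw [← hcomm.eq]; simp only [mul_assoc]
    _ = (Z.card ! : ℚ) • ((a * a) * b - ∑ y ∈ Z, a * of ℚ _ (swap y o) * a * b) := by
      rw [hbb, mul_smul_comm, mul_sub, mul_one, sub_mul, sub_mul, Finset.mul_sum, Finset.sum_mul,
        Finset.sum_mul]
    _ = _ := by
      rw [twistedSum_mul_self, Finset.sum_congr rfl hswap, Finset.sum_const, hf, hfd, hd,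
        ← Nat.cast_smul_eq_nsmul ℚ, smul_mul_assoc, smul_smul, ← sub_smul, smul_smul]
      congr 1
      ring

end Hook

/-! ### Cycles of a permutation and coefficients of (symmetrizer) × (antisymmetrizer). -/

section Orbits

variable {d : ℕ}

/-- The set of cycles of a permutation, fixed points included. -/
abbrev CycleSet (π : Perm (Fin d)) : Type := Quotient (Perm.SameCycle.setoid π)

/-- The cycle of `π` through `x`. -/
def cycleMk (π : Perm (Fin d)) (x : Fin d) : CycleSet π := Quotient.mk _ x

open Classical in
instance (π : Perm (Fin d)) : Fintype (CycleSet π) := Quotient.fintype _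

open Classical in
instance (π : Perm (Fin d)) : DecidableEq (CycleSet π) := Classical.decEq _

lemma cycleMk_eq_iff {π : Perm (Fin d)} {x y : Fin d} :
    cycleMk π x = cycleMk π y ↔ π.SameCycle x y := Quotient.eq

lemma cycleMk_surjective (π : Perm (Fin d)) : Function.Surjective (cycleMk π) :=
  Quotient.mk_surjective

@[simp] lemma cycleMk_apply (π : Perm (Fin d)) (x : Fin d) : cycleMk π (π x) = cycleMk π x :=
  cycleMk_eq_iff.2 (Perm.sameCycle_apply_left.2 (Perm.SameCycle.refl _ _))

/-- The number of points of a cycle. -/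
def cycleSize (π : Perm (Fin d)) (c : CycleSet π) : ℕ :=
  (Finset.univ.filter fun x => cycleMk π x = c).card

/-- The permutation that agrees with `π` on the cycles in `S` and is the identity elsewhere. -/
def onCycles (π : Perm (Fin d)) (S : Finset (CycleSet π)) : Perm (Fin d) :=
  Perm.ofSubtype (π.subtypePerm (p := fun x => cycleMk π x ∈ S) fun x => by simp)

lemma onCycles_apply (π : Perm (Fin d)) (S : Finset (CycleSet π)) (x : Fin d) :
    onCycles π S x = if cycleMk π x ∈ S then π x else x := by
  rw [onCycles]
  split_ifs with h
  · exact Perm.ofSubtype_apply_of_mem (p := fun x => cycleMk π x ∈ S) _ h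
  · exact Perm.ofSubtype_apply_of_not_mem (p := fun x => cycleMk π x ∈ S) _ h

lemma onCycles_singleton (π : Perm (Fin d)) (x : Fin d) :
    onCycles π {cycleMk π x} = π.cycleOf x := by
  ext1 y
  rw [onCycles_apply, Perm.cycleOf_apply]
  simp only [Finset.mem_singleton, cycleMk_eq_iff, Perm.sameCycle_comm]

lemma onCycles_insert (π : Perm (Fin d)) {S : Finset (CycleSet π)} {c : CycleSet π} (hc : c ∉ S) :
    onCycles π (insert c S) = onCycles π {c} * onCycles π S := by
  ext1 x
  rw [Perm.mul_apply, onCycles_apply, onCycles_apply π S, onCycles_apply]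
  by_cases h : cycleMk π x ∈ S
  · have : cycleMk π x ≠ c := fun h' => hc (h' ▸ h)
    simp [h, this]
  · by_cases h' : cycleMk π x = c
    · simp [h', hc]
    · simp [h, h']

lemma cycleSize_cycleMk_of_fixed {π : Perm (Fin d)} {x : Fin d} (h : π x = x) :
    cycleSize π (cycleMk π x) = 1 := by
  rw [cycleSize, Finset.card_eq_one]
  refine ⟨x, ?_⟩
  ext y
  simp only [Finset.mem_filter, Finset.mem_univ, true_and, Finset.mem_singleton, cycleMk_eq_iff]
  refine ⟨fun hy => ?_, fun hy => hy ▸ Perm.SameCycle.refl _ _⟩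
  exact (Perm.SameCycle.eq_of_right hy h)

lemma cycleSize_cycleMk_of_moved {π : Perm (Fin d)} {x : Fin d} (h : π x ≠ x) :
    cycleSize π (cycleMk π x) = (π.cycleOf x).support.card := by
  rw [cycleSize]
  congr 1
  ext y
  simp only [Finset.mem_filter, Finset.mem_univ, true_and, cycleMk_eq_iff]
  rw [Perm.mem_support_cycleOf_iff' h, Perm.sameCycle_comm]

lemma cycleSize_ne_one_of_moved {π : Perm (Fin d)} {x : Fin d} (h : π x ≠ x) :
    cycleSize π (cycleMk π x) ≠ 1 := by
  rw [cycleSize_cycleMk_of_moved h]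
  have := (Perm.isCycle_cycleOf π h).two_le_card_support
  omega

lemma signQ_onCycles_singleton (π : Perm (Fin d)) (c : CycleSet π) :
    signQ d (onCycles π {c}) = -(-1) ^ cycleSize π c := by
  obtain ⟨x, rfl⟩ := cycleMk_surjective π c
  rw [onCycles_singleton]
  by_cases h : π x = x
  · rw [cycleSize_cycleMk_of_fixed h, (Perm.cycleOf_eq_one_iff π).2 h]
    simp
  · rw [cycleSize_cycleMk_of_moved h, signQ_apply, (Perm.isCycle_cycleOf π h).sign]
    simp

lemma signQ_onCycles (π : Perm (Fin d)) (S : Finset (CycleSet π)) :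
    signQ d (onCycles π S) = ∏ c ∈ S, -(-1) ^ cycleSize π c := by
  induction S using Finset.induction_on with
  | empty =>
    have : onCycles π ∅ = 1 := by ext1 x; simp [onCycles_apply]
    rw [this]; simp
  | insert c S hc ih =>
    rw [onCycles_insert π hc, map_mul, ih, signQ_onCycles_singleton, Finset.prod_insert hc]

/-- The union of a set of cycles. -/
def cycleUnion (π : Perm (Fin d)) (S : Finset (CycleSet π)) : Finset (Fin d) :=
  Finset.univ.filter fun x => cycleMk π x ∈ S

lemma mem_cycleUnion {π : Perm (Fin d)} {S : Finset (CycleSet π)} {x : Fin d} :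
    x ∈ cycleUnion π S ↔ cycleMk π x ∈ S := by simp [cycleUnion]

lemma card_cycleUnion (π : Perm (Fin d)) (S : Finset (CycleSet π)) :
    (cycleUnion π S).card = ∑ c ∈ S, cycleSize π c := by
  rw [Finset.card_eq_sum_card_fiberwise (f := cycleMk π) (t := S)
    (fun x hx => mem_cycleUnion.1 hx)]
  refine Finset.sum_congr rfl fun c hc => ?_
  rw [cycleSize]
  congr 1
  ext x
  simp only [Finset.mem_filter, mem_cycleUnion, Finset.mem_univ, true_and]
  exact ⟨fun h => h.2, fun h => ⟨h ▸ hc, h⟩⟩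

lemma cycleUnion_injective (π : Perm (Fin d)) : Function.Injective (cycleUnion π) := by
  intro S T h
  ext c
  obtain ⟨x, rfl⟩ := cycleMk_surjective π c
  rw [← mem_cycleUnion, h, mem_cycleUnion]

lemma exists_cycleUnion_eq {π : Perm (Fin d)} {Z : Finset (Fin d)}
    (h : ∀ x, π x ∈ Z ↔ x ∈ Z) : ∃ S, cycleUnion π S = Z := by
  refine ⟨Z.image (cycleMk π), ?_⟩
  ext x
  rw [mem_cycleUnion, Finset.mem_image]
  refine ⟨?_, fun hx => ⟨x, hx, rfl⟩⟩
  rintro ⟨y, hy, hyx⟩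
  rw [cycleMk_eq_iff] at hyx
  obtain ⟨i, -, rfl⟩ := hyx.exists_pow_eq'
  clear hyx
  induction i with
  | zero => simpa using hy
  | succ i ih => rwa [pow_succ', Perm.mul_apply, h]

lemma coeff_twistedSum_compl_mul (π : Perm (Fin d)) (Z : Finset (Fin d)) :
    (twistedSum 1 Zᶜ * twistedSum (signQ d) Z).coeff π =
      ∑ q ∈ permsOn Zᶜ ×ˢ permsOn Z, if q.1 * q.2 = π then signQ d q.2 else 0 := by
  rw [twistedSum, twistedSum, Finset.sum_mul_sum, ← Finset.sum_product', coeff_sum,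
    Finsupp.finsetSum_apply]
  refine Finset.sum_congr rfl fun q _ => ?_
  rw [smul_mul_smul_comm, ← map_mul]
  simp [Finsupp.single_apply]

/-- A factorization of `π` into a permutation of `Zᶜ` and one of `Z` is unique: the factors are the
restrictions of `π`. So one term survives. -/
lemma coeff_twistedSum_cycleUnion (π : Perm (Fin d)) (S : Finset (CycleSet π)) :
    (twistedSum 1 (cycleUnion π S)ᶜ * twistedSum (signQ d) (cycleUnion π S)).coeff π =
      signQ d (onCycles π S) := by
  rw [coeff_twistedSum_compl_mul, Finset.sum_eq_single (onCycles π Sᶜ, onCycles π S)]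
  · rw [if_pos]
    ext1 x
    rw [Perm.mul_apply, onCycles_apply π S, onCycles_apply]
    by_cases h : cycleMk π x ∈ S <;> simp [h]
  · rintro ⟨p, r⟩ hq hne
    rw [Finset.mem_product] at hq
    refine if_neg fun h => hne ?_
    simp only at h hq
    have hr : r = onCycles π S := by
      ext1 x
      rw [onCycles_apply]
      split_ifs with hx
      · rw [← mem_cycleUnion, ← apply_mem_of_mem_permsOn hq.2] at hx
        rw [← h, Perm.mul_apply, mem_permsOn.1 hq.1 _ (by simpa using hx)]
      · exact mem_permsOn.1 hq.2 x (by rwa [mem_cycleUnion])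
    have hp : p = onCycles π Sᶜ := by
      rw [← mul_right_cancel_iff (a := onCycles π S), ← hr, h]
      ext1 x
      rw [Perm.mul_apply, hr, onCycles_apply π S, onCycles_apply]
      by_cases h : cycleMk π x ∈ S <;> simp [h]
    rw [hp, hr]
  · intro h
    refine absurd (Finset.mem_product.2 ⟨mem_permsOn.2 fun x hx => ?_,
      mem_permsOn.2 fun x hx => ?_⟩) h
    · simp [mem_cycleUnion] at hx
      simp [onCycles_apply, hx]
    · rw [mem_cycleUnion] at hx
      simp [onCycles_apply, hx]

lemma coeff_twistedSum_eq_zero {π : Perm (Fin d)} {Z : Finset (Fin d)}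
    (h : ∀ S, cycleUnion π S ≠ Z) :
    (twistedSum 1 Zᶜ * twistedSum (signQ d) Z).coeff π = 0 := by
  rw [coeff_twistedSum_compl_mul]
  refine Finset.sum_eq_zero fun q hq => if_neg fun hπ => ?_
  rw [Finset.mem_product] at hq
  have hinv : ∀ x, π x ∈ Z ↔ x ∈ Z := by
    intro x
    rw [← hπ, Perm.mul_apply, ← apply_mem_of_mem_permsOn hq.2 (x := x)]
    simpa using (apply_mem_of_mem_permsOn hq.1 (x := q.2 x)).not
  obtain ⟨S, hS⟩ := exists_cycleUnion_eq hinv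
  exact h S hS

/-- The parts of `π.partition` are the cycle type together with a `1` for each fixed point, so
cycles of size one are matched separately. -/
lemma prod_cycleSize {M : Type*} [CommMonoid M] (π : Perm (Fin d)) (F : ℕ → M) :
    ∏ c, F (cycleSize π c) = (π.partition.parts.map F).prod := by
  rw [Perm.parts_partition, Multiset.map_add, Multiset.prod_add, Multiset.map_replicate,
    Multiset.prod_replicate, Perm.cycleType_def, Multiset.map_map]
  rw [← Finset.prod_filter_not_mul_prod_filter Finset.univ (fun c => cycleSize π c = 1)]
  congr 1
  · refine Finset.prod_nbij (fun c => π.cycleOf c.out) ?_ ?_ ?_ ?_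
    all_goals
      have hout : ∀ c : CycleSet π, cycleMk π c.out = c := fun c => Quotient.out_eq c
      have hmv : ∀ c : CycleSet π, cycleSize π c ≠ 1 → π c.out ≠ c.out := fun c hc h =>
        hc (by rw [← hout c]; exact cycleSize_cycleMk_of_fixed h)
    · intro c hc
      rw [Perm.cycleOf_mem_cycleFactorsFinset_iff, Perm.mem_support]
      exact hmv c (Finset.mem_filter.1 hc).2
    · intro c hc c' hc' h
      have h1 := hmv c (Finset.mem_filter.1 hc).2
      have h2 := hmv c' (Finset.mem_filter.1 hc').2
      rw [← hout c, ← hout c', cycleMk_eq_iff]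
      have h3 : c'.out ∈ (π.cycleOf c.out).support := by
        simp only at h
        rw [h, Perm.mem_support_cycleOf_iff' h2]
      rwa [Perm.mem_support_cycleOf_iff' h1] at h3
    · intro g hg
      have hg' := Perm.mem_cycleFactorsFinset_iff.1 hg
      obtain ⟨x, hx⟩ := hg'.1.nonempty_support
      have hgx := (Perm.cycle_is_cycleOf hx hg)
      have hπx : π x ≠ x := by
        rw [← hg'.2 x hx]; exact Perm.mem_support.1 hx
      refine ⟨cycleMk π x, ?_, ?_⟩
      · simp [cycleSize_ne_one_of_moved hπx]
      · simp only
        rw [hgx]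
        refine Perm.SameCycle.cycleOf_eq ?_
        rw [← cycleMk_eq_iff, hout]
    · intro c hc
      have h1 := hmv c (Finset.mem_filter.1 hc).2
      conv_lhs => rw [← hout c, cycleSize_cycleMk_of_moved h1]
      rfl
  · rw [Finset.prod_congr rfl (g := fun _ => F 1) fun c hc => by rw [(Finset.mem_filter.1 hc).2],
      Finset.prod_const, ← Finset.card_compl]
    congr 1
    symm
    refine Finset.card_nbij (cycleMk π) ?_ ?_ ?_
    · intro x hx
      simp at hx
      simp [cycleSize_cycleMk_of_fixed hx]
    · intro x hx y hy h
      simp at hx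
      rw [cycleMk_eq_iff] at h
      exact h.eq_of_left hx
    · intro c hc
      obtain ⟨x, rfl⟩ := cycleMk_surjective π c
      refine ⟨x, ?_, rfl⟩
      by_contra h
      simp at h
      exact cycleSize_ne_one_of_moved h (Finset.mem_filter.1 hc).2

open Polynomial in
/-- The generating function of the characters of the exterior powers of the permutation
representation. -/
lemma sum_coeff_twistedSum (π : Perm (Fin d)) :
    ∑ Z : Finset (Fin d), C ((twistedSum 1 Zᶜ * twistedSum (signQ d) Z).coeff π) * X ^ Z.card =
      (π.partition.parts.map fun b => 1 - (-X : Polynomial ℚ) ^ b).prod := by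
  rw [← prod_cycleSize]
  simp only [sub_eq_add_neg]
  -- Expanding the product gives one term per set `S` of cycles; it matches `Z = cycleUnion π S`,
  -- and every `Z` that is not a union of cycles has coefficient zero.
  rw [Finset.prod_one_add, Finset.powerset_univ]
  symm
  refine Finset.sum_of_injOn (cycleUnion π) (cycleUnion_injective π).injOn
    (fun _ _ => Finset.mem_coe.2 (Finset.mem_univ _)) ?_ ?_
  · intro Z _ hZ
    rw [coeff_twistedSum_eq_zero fun S hS => hZ ⟨S, by simp, hS⟩, C_0, zero_mul]
  · intro S _
    rw [coeff_twistedSum_cycleUnion, signQ_onCycles, card_cycleUnion, ← Finset.prod_pow_eq_pow_sum,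
      map_prod, ← Finset.prod_mul_distrib]
    refine Finset.prod_congr rfl fun c _ => ?_
    rw [neg_pow (X : Polynomial ℚ)]
    simp

end Orbits

/-! ### Generating function of the hook characters. -/

section HookCharacter

variable {d : ℕ}

lemma exists_perm_map_eq {Z Z' : Finset (Fin d)} {o o' : Fin d} (ho : o ∉ Z) (ho' : o' ∉ Z')
    (h : Z.card = Z'.card) : ∃ g : Perm (Fin d), Z.map g.toEmbedding = Z' ∧ g o = o' := by
  obtain ⟨e⟩ : Nonempty ({x // x ∈ Z} ≃ {x // x ∈ Z'}) := ⟨Finset.equivOfCardEq h⟩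
  set g := e.extendSubtype with hg
  have hgo : g o ∉ Z' := e.extendSubtype_not_mem o ho
  have hsub : ∀ x ∈ Z, g x ∈ Z' := fun x hx => e.extendSubtype_mem x hx
  refine ⟨swap (g o) o' * g, ?_, by simp⟩
  refine Finset.eq_of_subset_of_card_le ?_ (by rw [Finset.card_map, h])
  intro x hx
  rw [Finset.mem_map] at hx
  obtain ⟨z, hz, rfl⟩ := hx
  have hz' := hsub z hz
  change swap (g o) o' (g z) ∈ Z'
  have h1 : g z ≠ g o := fun h => hgo (h ▸ hz')
  have h2 : g z ≠ o' := fun h => ho' (h ▸ hz')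
  rw [swap_apply_of_ne_of_ne h1 h2]
  exact hz'

lemma conjTrace_hookElement_congr (σ : Perm (Fin d)) {Z Z' : Finset (Fin d)} {o o' : Fin d}
    (ho : o ∉ Z) (ho' : o' ∉ Z') (h : Z.card = Z'.card) :
    conjTrace σ (hookElement Z o) = conjTrace σ (hookElement Z' o') := by
  obtain ⟨g, rfl, rfl⟩ := exists_perm_map_eq ho ho' h
  have h1 : hookElement (Z.map g.toEmbedding) (g o) =
      of ℚ _ g * (hookElement Z o * of ℚ _ g⁻¹) := by
    have hc : (Z.map g.toEmbedding)ᶜ = Zᶜ.map g.toEmbedding := by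
      ext x
      simp
    have hi : insert (g o) (Z.map g.toEmbedding) = (insert o Z).map g.toEmbedding := by
      rw [Finset.map_insert]; rfl
    have hg : of ℚ (Perm (Fin d)) g⁻¹ * of ℚ (Perm (Fin d)) g = 1 := by
      rw [← map_mul, inv_mul_cancel, map_one]
    rw [hookElement, hc, hi, ← twistedSum_conj, ← twistedSum_conj, hookElement]
    simp only [mul_assoc]
    rw [← mul_assoc (of ℚ (Perm (Fin d)) g⁻¹) (of ℚ (Perm (Fin d)) g), hg, one_mul]
  rw [h1, conjTrace_of_mul, mul_assoc, ← map_mul, inv_mul_cancel, map_one, mul_one]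

/-- The character of the hook shape with `k` boxes below the first row. -/
def hookChar (k : ℕ) (σ : Perm (Fin d)) : ℚ :=
  (∑ Z ∈ Finset.powersetCard k Finset.univ, ∑ o ∈ Zᶜ, conjTrace σ (hookElement Z o)) / (d * d !)

/-- All pairs `(Z, o)` with the same `|Z| = k` have equal trace. There are `(d choose k) (d - k)` of
them, and this count times the constant of `hookElement_sq` is `d * d!`, the denominator in
`hookChar`. -/
lemma conjTrace_hookElement (σ : Perm (Fin d)) {Z : Finset (Fin d)} {o : Fin d} (ho : o ∉ Z) :
    conjTrace σ (hookElement Z o) =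
      ((d : ℚ) * (d - 1 - Z.card)! * Z.card !) * hookChar Z.card σ := by
  have hlt : Z.card < d := by
    have := Finset.card_lt_univ_of_notMem ho
    simpa using this
  have hsum : ∑ W ∈ Finset.powersetCard Z.card Finset.univ, ∑ p ∈ Wᶜ,
      conjTrace σ (hookElement W p) =
      (d.choose Z.card : ℚ) * ((d - Z.card : ℕ) * conjTrace σ (hookElement Z o)) := by
    rw [Finset.sum_congr rfl
      (g := fun _ => ((d - Z.card : ℕ) : ℚ) * conjTrace σ (hookElement Z o)), Finset.sum_const,
      Finset.card_powersetCard, Finset.card_univ, Fintype.card_fin, nsmul_eq_mul]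
    intro W hW
    have hW' := (Finset.mem_powersetCard.1 hW).2
    rw [Finset.sum_congr rfl (g := fun _ => conjTrace σ (hookElement Z o)), Finset.sum_const,
      Finset.card_compl, Fintype.card_fin, nsmul_eq_mul, hW']
    intro p hp
    exact conjTrace_hookElement_congr σ (by simpa using hp) ho hW'
  have hd : (d : ℚ) ≠ 0 := by
    have : d ≠ 0 := by omega
    exact_mod_cast this
  have hd' : (d ! : ℚ) ≠ 0 := by exact_mod_cast d.factorial_ne_zero
  have hc : (d.choose Z.card : ℚ) * Z.card ! * (d - Z.card)! = d ! := by
    exact_mod_cast Nat.choose_mul_factorial_mul_factorial hlt.le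
  have hf : ((d - Z.card)! : ℚ) = (d - Z.card : ℕ) * (d - 1 - Z.card)! := by
    rw [show d - 1 - Z.card = d - Z.card - 1 by omega, ← Nat.cast_mul,
      Nat.mul_factorial_pred (by omega)]
  rw [hookChar, hsum]
  rw [hf] at hc
  field_simp
  rw [← hc]
  ring

/-- Expand the antisymmetrizer in the first sum and the symmetrizer in the second: the terms `a b *
swap o y` occur with opposite signs and cancel, leaving `|Zᶜ| + |Z| = d` copies of the main term.
This is the splitting of an exterior power of the permutation representation into hooks with legs
`|Z|` and `|Z| - 1`. -/
lemma sum_conjTrace_hookElement (σ : Perm (Fin d)) (Z : Finset (Fin d)) :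
    ∑ o ∈ Zᶜ, conjTrace σ (hookElement Z o) + ∑ y ∈ Z, conjTrace σ (hookElement (Z.erase y) y) =
      d * conjTrace σ (twistedSum 1 Zᶜ * twistedSum (signQ d) Z) := by
  set a := twistedSum 1 Zᶜ with ha
  set b := twistedSum (signQ d) Z with hb
  have hcomm : Commute a b := commute_twistedSum _ _ disjoint_compl_left
  have h1 : ∀ o ∈ Zᶜ, conjTrace σ (hookElement Z o) =
      conjTrace σ (a * b) - ∑ y ∈ Z, conjTrace σ (a * b * of ℚ _ (swap o y)) := by
    intro o ho
    have ho' : o ∉ Z := by simpa using ho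
    rw [hookElement, twistedSum_insert _ ho', ← mul_assoc, mul_add, mul_one, map_add,
      Finset.mul_sum, map_sum, sub_eq_add_neg, ← Finset.sum_neg_distrib]
    congr 1
    refine Finset.sum_congr rfl fun y hy => ?_
    have : y ≠ o := fun h => ho' (h ▸ hy)
    rw [signQ_apply, Perm.sign_swap this, swap_comm, mul_smul_comm, map_smul]
    simp [a, b]
  have h2 : ∀ y ∈ Z, conjTrace σ (hookElement (Z.erase y) y) =
      conjTrace σ (a * b) + ∑ o ∈ Zᶜ, conjTrace σ (a * b * of ℚ _ (swap o y)) := by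
    intro y hy
    have hy' : y ∉ Zᶜ := by simpa using hy
    rw [hookElement, Finset.compl_erase, Finset.insert_erase hy, twistedSum_insert _ hy',
      mul_add, mul_one, add_mul, map_add, Finset.mul_sum, Finset.sum_mul, map_sum]
    congr 1
    refine Finset.sum_congr rfl fun o _ => ?_
    rw [hcomm.eq, mul_assoc b, conjTrace_mul_comm σ b]
    simp [a, b]
  rw [Finset.sum_congr rfl h1, Finset.sum_congr rfl h2, Finset.sum_sub_distrib,
    Finset.sum_add_distrib, Finset.sum_comm (s := Z) (t := Zᶜ)]
  have hd : (d : ℚ) = Zᶜ.card + Z.card := by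
    rw [← Nat.cast_add, Finset.card_compl_add_card, Fintype.card_fin]
  simp only [Finset.sum_const, nsmul_eq_mul]
  rw [hd]
  ring

lemma partition_parts_conj_inv (π g : Perm (Fin d)) :
    (g⁻¹ * π⁻¹ * g).partition.parts = π.partition.parts := by
  have : (g⁻¹ * π⁻¹ * g).partition = π.partition := by
    refine Perm.partition_eq_of_isConj.1 (Perm.isConj_iff_cycleType_eq.2 ?_)
    have := Perm.cycleType_conj (σ := π⁻¹) (τ := g⁻¹)
    rw [inv_inv] at this
    rw [this, Perm.cycleType_inv]
  rw [this]

open Polynomial in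
/-- The generating function of the hook characters. -/
lemma one_add_X_mul_sum_hookChar (hd : d ≠ 0) (σ : Perm (Fin d)) :
    (1 + X) * ∑ k ∈ Finset.range d, C (hookChar k σ) * X ^ k =
      (σ.partition.parts.map fun b => 1 - (-X : Polynomial ℚ) ^ b).prod := by
  set Θ : Polynomial ℚ := ∑ Z : Finset (Fin d), ∑ o ∈ Zᶜ,
    C (conjTrace σ (hookElement Z o)) * X ^ Z.card with hΘ
  have hN : ((d : ℚ) * d !) ≠ 0 := by
    have : d * d ! ≠ 0 := mul_ne_zero hd d.factorial_ne_zero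
    exact_mod_cast this
  have h1 : C ((d : ℚ) * d !) * ∑ k ∈ Finset.range d, C (hookChar k σ) * X ^ k = Θ := by
    have hΘ' : Θ = ∑ k ∈ Finset.range (d + 1),
        C (∑ Z ∈ Finset.powersetCard k Finset.univ, ∑ o ∈ Zᶜ, conjTrace σ (hookElement Z o)) *
          X ^ k := by
      rw [hΘ, ← Finset.powerset_univ, Finset.sum_powerset, Finset.card_univ, Fintype.card_fin]
      refine Finset.sum_congr rfl fun k _ => ?_
      rw [map_sum, Finset.sum_mul]
      refine Finset.sum_congr rfl fun Z hZ => ?_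
      rw [map_sum, Finset.sum_mul, (Finset.mem_powersetCard.1 hZ).2]
    -- The term `k = d` is empty, since no `o` lies outside `Z = univ`.
    have hlast : Finset.powersetCard d (Finset.univ : Finset (Fin d)) = {Finset.univ} := by
      have := Finset.powersetCard_self (Finset.univ : Finset (Fin d))
      rwa [Finset.card_univ, Fintype.card_fin] at this
    rw [hΘ', Finset.sum_range_succ, hlast]
    simp only [Finset.sum_singleton, Finset.compl_univ, Finset.sum_empty, C_0, zero_mul, add_zero]
    rw [Finset.mul_sum]
    refine Finset.sum_congr rfl fun k _ => ?_
    rw [← mul_assoc, ← C_mul, hookChar, mul_div_cancel₀ _ hN]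
  -- Moving `o` into `Z` raises the degree by one, so `X * Θ` collects the other hook of each
  -- adjacent pair.
  have h2 : X * Θ = ∑ Z : Finset (Fin d), ∑ y ∈ Z,
      C (conjTrace σ (hookElement (Z.erase y) y)) * X ^ Z.card := by
    rw [hΘ, Finset.mul_sum]
    simp_rw [Finset.mul_sum]
    rw [Finset.sum_sigma', Finset.sum_sigma']
    refine Finset.sum_nbij' (fun q => ⟨insert q.2 q.1, q.2⟩) (fun q => ⟨q.1.erase q.2, q.2⟩)
      ?_ ?_ ?_ ?_ ?_
    · simp
    · simp
    · rintro ⟨Z, o⟩ h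
      simp at h
      simp [Finset.erase_insert h]
    · rintro ⟨Z, o⟩ h
      simp at h
      simp [Finset.insert_erase h]
    · rintro ⟨Z, o⟩ h
      simp at h
      simp only [Finset.erase_insert h, Finset.card_insert_of_notMem h]
      ring
  have h3 : (1 + X) * Θ = C (d : ℚ) * ∑ Z : Finset (Fin d),
      C (conjTrace σ (twistedSum 1 Zᶜ * twistedSum (signQ d) Z)) * X ^ Z.card := by
    rw [add_mul, one_mul, h2, hΘ, ← Finset.sum_add_distrib, Finset.mul_sum]
    refine Finset.sum_congr rfl fun Z _ => ?_
    rw [← mul_assoc, ← C_mul, ← sum_conjTrace_hookElement, ← Finset.sum_mul, ← Finset.sum_mul,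
      ← add_mul, C_add, map_sum, map_sum]
  have h4 : ∑ Z : Finset (Fin d),
      C (conjTrace σ (twistedSum 1 Zᶜ * twistedSum (signQ d) Z)) * X ^ Z.card =
      C (d ! : ℚ) * (σ.partition.parts.map fun b => 1 - (-X : Polynomial ℚ) ^ b).prod := by
    simp_rw [conjTrace_apply, map_sum, Finset.sum_mul]
    rw [Finset.sum_comm]
    simp_rw [sum_coeff_twistedSum]
    rw [Finset.sum_congr rfl
      (g := fun _ => (σ.partition.parts.map fun b => 1 - (-X : Polynomial ℚ) ^ b).prod)]
    · have hcard : (Finset.univ : Finset (Perm (Fin d))).card = d ! := by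
        rw [Finset.card_univ, Fintype.card_perm, Fintype.card_fin]
      rw [Finset.sum_const, hcard, nsmul_eq_mul]
      simp
    · intro g _
      rw [partition_parts_conj_inv]
  have h5 : C ((d : ℚ) * d !) * ((1 + X) * ∑ k ∈ Finset.range d, C (hookChar k σ) * X ^ k) =
      C ((d : ℚ) * d !) * (σ.partition.parts.map fun b => 1 - (-X : Polynomial ℚ) ^ b).prod := by
    rw [mul_left_comm, h1, h3, h4, ← mul_assoc, ← C_mul]
  exact mul_left_cancel₀ (C_ne_zero.2 hN) h5

end HookCharacter

/-! ### Hook characters at long cycles. -/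

section LongCycle

variable {d : ℕ}

open Polynomial in
lemma one_sub_X_mul_sum_hookChar (hd : d ≠ 0) (σ : Perm (Fin d)) :
    (1 - X) * ∑ k ∈ Finset.range d, C ((-1) ^ k * hookChar k σ) * X ^ k =
      (σ.partition.parts.map fun b => 1 - (X : Polynomial ℚ) ^ b).prod := by
  have h := congrArg (fun p : Polynomial ℚ => p.comp (-X)) (one_add_X_mul_sum_hookChar hd σ)
  simp only [mul_comp, add_comp, one_comp, X_comp, Polynomial.sum_comp, C_comp, pow_comp,
    multiset_prod_comp, Multiset.map_map, Function.comp_def, sub_comp, neg_comp, neg_neg] at h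
  rw [← h, sub_eq_add_neg]
  congr 1
  refine Finset.sum_congr rfl fun k _ => ?_
  rw [neg_pow (X : Polynomial ℚ)]
  simp
  ring

lemma one_sub_X_ne_zero : (1 - Polynomial.X : Polynomial ℚ) ≠ 0 := fun h => by
  simpa using congrArg (Polynomial.eval 0) h

open Polynomial in
-- Here the generating function is `(1 - X^d) / (1 - X)`, all of whose coefficients below degree `d`
-- are `1`.
lemma hookChar_of_parts_eq_singleton {σ : Perm (Fin d)} (hσ : σ.partition.parts = {d})
    {k : ℕ} (hk : k < d) : hookChar k σ = (-1) ^ k := by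
  have h := one_sub_X_mul_sum_hookChar (by omega) σ
  rw [hσ, Multiset.map_singleton, Multiset.prod_singleton, ← mul_neg_geom_sum] at h
  have h' := congrArg (fun p : Polynomial ℚ => p.coeff k) (mul_left_cancel₀ one_sub_X_ne_zero h)
  simp only [finsetSum_coeff, coeff_C_mul, coeff_X_pow] at h'
  simp [hk] at h'
  calc hookChar k σ = ((-1) ^ k * (-1) ^ k) * hookChar k σ := by rw [← mul_pow]; simp
    _ = (-1) ^ k := by rw [mul_assoc, h', mul_one]

open Polynomial in
/-- The alternating sum of the hook characters is supported on the long cycles. -/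
lemma sum_neg_one_pow_mul_hookChar (hd : d ≠ 0) (σ : Perm (Fin d)) :
    ∑ k ∈ Finset.range d, (-1) ^ k * hookChar k σ =
      if σ.partition.parts = {d} then (d : ℚ) else 0 := by
  split_ifs with hσ
  · rw [Finset.sum_congr rfl (g := fun _ => (1 : ℚ))]
    · simp
    · intro k hk
      rw [hookChar_of_parts_eq_singleton hσ (Finset.mem_range.1 hk), ← mul_pow]
      simp
  · have h := one_sub_X_mul_sum_hookChar hd σ
    have hsum : σ.partition.parts.sum = d := by
      rw [σ.partition.parts_sum, Fintype.card_fin]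
    -- With at least two parts, the product still vanishes at `X = 1` after one factor `1 - X` is
    -- cancelled.
    obtain ⟨a, ha⟩ := Multiset.exists_mem_of_ne_zero (s := σ.partition.parts) (by
      intro h0; rw [h0] at hsum; exact hd hsum.symm)
    obtain ⟨t, ht⟩ := Multiset.exists_cons_of_mem ha
    obtain ⟨b, hb⟩ := Multiset.exists_mem_of_ne_zero (s := t) (by
      intro h0
      rw [ht, h0] at hsum hσ
      simp at hsum hσ
      exact hσ hsum)
    obtain ⟨u, hu⟩ := Multiset.exists_cons_of_mem hb
    rw [ht, hu, Multiset.map_cons, Multiset.map_cons, Multiset.prod_cons, Multiset.prod_cons,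
      ← mul_neg_geom_sum, mul_assoc] at h
    have h' := congrArg (Polynomial.eval 1) (mul_left_cancel₀ one_sub_X_ne_zero h)
    simpa [eval_finsetSum] using h'

end LongCycle

/-! ### Vanishing of non-hook characters at long cycles. -/

section NonHook

variable {d : ℕ} {lam : d.Partition}

lemma card_filter_row (T : Tableau lam) (i : ℕ) :
    (Finset.univ.filter fun x => T.row x = i).card = (diagram lam).rowLen i := by
  rw [YoungDiagram.rowLen_eq_card]
  refine Finset.card_bij (fun x _ => (T.symm x).1) ?_ ?_ ?_
  · intro x hx
    rw [YoungDiagram.mem_row_iff]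
    exact ⟨(T.symm x).2, (Finset.mem_filter.1 hx).2⟩
  · intro x _ y _ h
    exact T.symm.injective (Subtype.ext h)
  · intro c hc
    rw [YoungDiagram.mem_row_iff] at hc
    exact ⟨T ⟨c, hc.1⟩, Finset.mem_filter.2 ⟨Finset.mem_univ _, by simp [Tableau.row, hc.2]⟩, by simp⟩

lemma card_filter_col (T : Tableau lam) (j : ℕ) :
    (Finset.univ.filter fun x => T.col x = j).card = (diagram lam).colLen j := by
  rw [YoungDiagram.colLen_eq_card]
  refine Finset.card_bij (fun x _ => (T.symm x).1) ?_ ?_ ?_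
  · intro x hx
    rw [YoungDiagram.mem_col_iff]
    exact ⟨(T.symm x).2, (Finset.mem_filter.1 hx).2⟩
  · intro x _ y _ h
    exact T.symm.injective (Subtype.ext h)
  · intro c hc
    rw [YoungDiagram.mem_col_iff] at hc
    exact ⟨T ⟨c, hc.1⟩, Finset.mem_filter.2 ⟨Finset.mem_univ _, by simp [Tableau.col, hc.2]⟩, by simp⟩

lemma row_lt (T : Tableau lam) (x : Fin d) : T.row x < (diagram lam).colLen 0 := by
  rw [← YoungDiagram.mem_iff_lt_colLen]
  exact (diagram lam).up_left_mem le_rfl (Nat.zero_le _) (T.symm x).2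

lemma col_lt (T : Tableau lam) (x : Fin d) : T.col x < (diagram lam).rowLen 0 := by
  rw [← YoungDiagram.mem_iff_lt_rowLen]
  exact (diagram lam).up_left_mem (Nat.zero_le _) le_rfl (T.symm x).2

lemma rowSymmetrizer_mul_swap (T : Tableau lam) {x y : Fin d} (h : T.row x = T.row y) :
    rowSymmetrizer T * of ℚ _ (swap x y) = rowSymmetrizer T := by
  have hs : ∀ z, T.row (swap x y z) = T.row z := by
    intro z
    rw [swap_apply_def]
    split_ifs with h1 h2
    · rw [h1, h]
    · rw [h2, h]
    · rfl
  rw [rowSymmetrizer, Finset.sum_mul]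
  refine Finset.sum_nbij' (fun p => p * swap x y) (fun p => p * swap x y) ?_ ?_ ?_ ?_ ?_
  · intro p hp
    simp only [Finset.mem_filter, Finset.mem_univ, true_and] at hp ⊢
    intro z
    rw [Perm.mul_apply, hp, hs]
  · intro p hp
    simp only [Finset.mem_filter, Finset.mem_univ, true_and] at hp ⊢
    intro z
    rw [Perm.mul_apply, hp, hs]
  · simp [mul_assoc]
  · simp [mul_assoc]
  · intro p _
    rw [← map_mul]

lemma colAntisymmetrizer_mul_swap (T : Tableau lam) {x y : Fin d} (hxy : x ≠ y)
    (h : T.col x = T.col y) :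
    colAntisymmetrizer T * of ℚ _ (swap x y) = -colAntisymmetrizer T := by
  have hs : ∀ z, T.col (swap x y z) = T.col z := by
    intro z
    rw [swap_apply_def]
    split_ifs with h1 h2
    · rw [h1, h]
    · rw [h2, h]
    · rfl
  rw [colAntisymmetrizer, Finset.sum_mul, ← Finset.sum_neg_distrib]
  refine Finset.sum_nbij' (fun p => p * swap x y) (fun p => p * swap x y) ?_ ?_ ?_ ?_ ?_
  · intro p hp
    simp only [Finset.mem_filter, Finset.mem_univ, true_and] at hp ⊢
    intro z
    rw [Perm.mul_apply, hp, hs]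
  · intro p hp
    simp only [Finset.mem_filter, Finset.mem_univ, true_and] at hp ⊢
    intro z
    rw [Perm.mul_apply, hp, hs]
  · simp [mul_assoc]
  · simp [mul_assoc]
  · intro p _
    rw [smul_mul_assoc, ← map_mul, Perm.sign_mul, Perm.sign_swap hxy]
    simp

/-- Pigeonhole: `Y` has more elements than there are rows, so any `g` sends two of them into one
row. Their transposition is absorbed by the row symmetrizer and negates the other factor. -/
lemma rowSymmetrizer_mul_mul_twistedSum (T : Tableau lam) {Y : Finset (Fin d)}
    (hY : (diagram lam).colLen 0 < Y.card) (z : GroupAlg d) :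
    rowSymmetrizer T * (z * twistedSum (signQ d) Y) = 0 := by
  rw [groupAlg_eq_sum z, Finset.sum_mul, Finset.mul_sum]
  refine Finset.sum_eq_zero fun g _ => ?_
  rw [smul_mul_assoc, mul_smul_comm]
  obtain ⟨u, hu, v, hv, huv, h⟩ := Finset.exists_ne_map_eq_of_card_lt_of_maps_to
    (s := Y) (t := Finset.range ((diagram lam).colLen 0)) (by simpa using hY)
    (f := fun x => T.row (g x)) (fun x _ => by simpa using row_lt T (g x))
  have h1 : of ℚ _ g * twistedSum (signQ d) Y =
      -(of ℚ _ (swap (g u) (g v)) * (of ℚ _ g * twistedSum (signQ d) Y)) := by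
    rw [← mul_assoc, ← map_mul, ← mul_swap_eq_swap_mul, map_mul, mul_assoc,
      of_mul_twistedSum _ (swap_mem_permsOn hu hv)]
    simp [Perm.sign_swap huv]
  have h2 : rowSymmetrizer T * (of ℚ _ g * twistedSum (signQ d) Y) =
      -(rowSymmetrizer T * (of ℚ _ g * twistedSum (signQ d) Y)) := by
    conv_lhs => rw [h1, mul_neg, ← mul_assoc, rowSymmetrizer_mul_swap T h]
  rw [eq_zero_of_eq_neg_self h2, smul_zero]

lemma colAntisymmetrizer_mul_mul_twistedSum (T : Tableau lam) {X : Finset (Fin d)}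
    (hX : (diagram lam).rowLen 0 < X.card) (z : GroupAlg d) :
    colAntisymmetrizer T * (z * twistedSum 1 X) = 0 := by
  rw [groupAlg_eq_sum z, Finset.sum_mul, Finset.mul_sum]
  refine Finset.sum_eq_zero fun g _ => ?_
  rw [smul_mul_assoc, mul_smul_comm]
  obtain ⟨u, hu, v, hv, huv, h⟩ := Finset.exists_ne_map_eq_of_card_lt_of_maps_to
    (s := X) (t := Finset.range ((diagram lam).rowLen 0)) (by simpa using hX)
    (f := fun x => T.col (g x)) (fun x _ => by simpa using col_lt T (g x))
  have h1 : of ℚ _ g * twistedSum 1 X =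
      of ℚ _ (swap (g u) (g v)) * (of ℚ _ g * twistedSum 1 X) := by
    rw [← mul_assoc, ← map_mul, ← mul_swap_eq_swap_mul, map_mul, mul_assoc,
      of_mul_twistedSum _ (swap_mem_permsOn hu hv)]
    simp
  have h2 : colAntisymmetrizer T * (of ℚ _ g * twistedSum 1 X) =
      -(colAntisymmetrizer T * (of ℚ _ g * twistedSum 1 X)) := by
    conv_lhs => rw [h1, ← mul_assoc,
      colAntisymmetrizer_mul_swap T (fun h' => huv (g.injective h')) h, neg_mul]
  rw [eq_zero_of_eq_neg_self h2, smul_zero]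

/-- The first row and the first column share only the corner, and both miss the cell `(1, 1)`. -/
lemma colLen_add_rowLen_le (h : (1, 1) ∈ diagram lam) :
    (diagram lam).colLen 0 + (diagram lam).rowLen 0 ≤ d := by
  set μ := diagram lam with hμ
  have hcard : μ.cells.card = d := card_diagram lam
  have h1 : μ.col 0 ∪ μ.row 0 ⊆ μ.cells.erase (1, 1) := by
    intro c hc
    rw [Finset.mem_union, YoungDiagram.mem_col_iff, YoungDiagram.mem_row_iff] at hc
    rw [Finset.mem_erase]
    refine ⟨?_, ?_⟩
    · rintro rfl
      simp at hc
    · rcases hc with hc | hc <;> exact hc.1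
  have h2 : μ.col 0 ∩ μ.row 0 ⊆ {(0, 0)} := by
    intro c hc
    rw [Finset.mem_inter, YoungDiagram.mem_col_iff, YoungDiagram.mem_row_iff] at hc
    rw [Finset.mem_singleton]
    exact Prod.ext hc.2.2 hc.1.2
  have h3 := Finset.card_le_card h1
  have h4 := Finset.card_le_card h2
  have h5 := Finset.card_union_add_card_inter (μ.col 0) (μ.row 0)
  have h6 : (1, 1) ∈ μ.cells := h
  rw [Finset.card_erase_of_mem h6] at h3
  have h7 : 0 < μ.cells.card := Finset.card_pos.2 ⟨_, h6⟩
  rw [Finset.card_singleton] at h4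
  rw [YoungDiagram.colLen_eq_card, YoungDiagram.rowLen_eq_card]
  omega

/-- Because `lam` contains `(1, 1)`, no hook fits: either the hook's column is longer than the first
column of `lam`, or its row is longer than the first row. One of the two pigeonhole lemmas applies.
-/
lemma youngSymmetrizer_mul_mul_hookElement (T : Tableau lam) (h : (1, 1) ∈ diagram lam)
    {Z : Finset (Fin d)} {o : Fin d} (ho : o ∉ Z) (z : GroupAlg d) :
    youngSymmetrizer T * (z * hookElement Z o) = 0 := by
  have hle := colLen_add_rowLen_le h
  have hc : (insert o Z).card = Z.card + 1 := Finset.card_insert_of_notMem ho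
  have hc' : Zᶜ.card + Z.card = d := by rw [Finset.card_compl_add_card, Fintype.card_fin]
  by_cases hY : (diagram lam).colLen 0 < (insert o Z).card
  · have : youngSymmetrizer T * (z * hookElement Z o) = rowSymmetrizer T *
        ((colAntisymmetrizer T * z * twistedSum 1 Zᶜ) * twistedSum (signQ d) (insert o Z)) := by
      simp only [youngSymmetrizer, hookElement, mul_assoc]
    rw [this, rowSymmetrizer_mul_mul_twistedSum T hY]
  · have : youngSymmetrizer T * (z * hookElement Z o) = rowSymmetrizer T *
        ((colAntisymmetrizer T * (z * twistedSum 1 Zᶜ)) * twistedSum (signQ d) (insert o Z)) := by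
      simp only [youngSymmetrizer, hookElement, mul_assoc]
    rw [this, colAntisymmetrizer_mul_mul_twistedSum T (by omega), zero_mul, mul_zero]

/-- The sum is the trace of `y ↦ z * y * x` on the group algebra, and that operator is zero. -/
lemma sum_coeff_mul_conjTrace (z x : GroupAlg d) (h : ∀ y, z * (y * x) = 0) :
    ∑ π, z.coeff π * conjTrace π x = 0 := by
  have h1 : ∀ π, z.coeff π * conjTrace π x =
      ∑ g, ((z.coeff π • of ℚ _ π) * (of ℚ _ g * x)).coeff g := by
    intro π
    rw [conjTrace_eq_sum_coeff, Finset.mul_sum]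
    refine Finset.sum_congr rfl fun g _ => ?_
    rw [smul_mul_assoc, coeff_smul_apply, smul_eq_mul]
  rw [Finset.sum_congr rfl fun π _ => h1 π, Finset.sum_comm]
  refine Finset.sum_eq_zero fun g _ => ?_
  rw [← Finsupp.finsetSum_apply, ← coeff_sum, ← Finset.sum_mul, ← groupAlg_eq_sum, h]
  simp

lemma sum_coeff_mul_hookChar (h : (1, 1) ∈ diagram lam) (T : Tableau lam) (x : GroupAlg d)
    (k : ℕ) : ∑ π, (x * youngSymmetrizer T).coeff π * hookChar k π = 0 := by
  simp_rw [hookChar, ← mul_div_assoc]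
  rw [← Finset.sum_div]
  simp_rw [Finset.mul_sum]
  rw [Finset.sum_comm, Finset.sum_eq_zero, zero_div]
  intro Z _
  rw [Finset.sum_comm]
  refine Finset.sum_eq_zero fun o ho => sum_coeff_mul_conjTrace _ _ fun y => ?_
  rw [mul_assoc, youngSymmetrizer_mul_mul_hookElement T h (by simpa using ho), mul_zero]

lemma irrChar_congr {σ π : Perm (Fin d)} (lam : d.Partition)
    (h : σ.partition.parts = π.partition.parts) : irrChar lam σ = irrChar lam π := by
  obtain ⟨g, hg⟩ := isConj_iff.1 (Perm.partition_eq_of_isConj.2 (Nat.Partition.ext h))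
  rw [← hg, irrChar_conj]

/-- Only hooks contribute to the character value at a long cycle. -/
theorem irrChar_long_cycle_eq_zero (h : (1, 1) ∈ diagram lam) {σ : Perm (Fin d)}
    (hσ : σ.partition.parts = {d}) : irrChar lam σ = 0 := by
  classical
  have hd : d ≠ 0 := by
    rintro rfl
    have := σ.partition.parts_pos (i := 0) (by rw [hσ]; simp)
    exact lt_irrefl _ this
  obtain ⟨x, hx⟩ := exists_irrChar_eq_conjTrace lam
  set z := x * youngSymmetrizer (someTableau lam) with hz
  have h1 : ∑ π, z.coeff π * (if π.partition.parts = {d} then (d : ℚ) else 0) = 0 := by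
    simp_rw [← sum_neg_one_pow_mul_hookChar hd, Finset.mul_sum]
    rw [Finset.sum_comm]
    refine Finset.sum_eq_zero fun k _ => ?_
    simp_rw [mul_left_comm _ ((-1 : ℚ) ^ k)]
    rw [← Finset.mul_sum, sum_coeff_mul_hookChar h, mul_zero]
  -- The character sums coefficients of `z` at conjugates of `π⁻¹`; each substitution `π ↦ g⁻¹ * π⁻¹
  -- * g` preserves the cycle type and reduces to `h1`.
  have h2 : ∑ π, irrChar lam π * (if π.partition.parts = {d} then (d : ℚ) else 0) = 0 := by
    simp_rw [hx, conjTrace_apply, Finset.sum_mul]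
    rw [Finset.sum_comm]
    refine Finset.sum_eq_zero fun g _ => ?_
    refine Eq.trans ?_ h1
    refine Fintype.sum_bijective (fun π => g⁻¹ * π⁻¹ * g) ?_ _ _ fun π => ?_
    · refine Finite.injective_iff_bijective.1 fun π π' hπ => ?_
      simpa using hπ
    · rw [partition_parts_conj_inv]
  -- The character is constant on `d`-cycles, so it factors out of a sum that is positive.
  have h3 : ∀ π : Perm (Fin d), irrChar lam π * (if π.partition.parts = {d} then (d : ℚ) else 0) =
      irrChar lam σ * (if π.partition.parts = {d} then (d : ℚ) else 0) := by
    intro π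
    split_ifs with hπ
    · rw [irrChar_congr lam (hπ.trans hσ.symm)]
    · simp
  simp_rw [h3] at h2
  rw [← Finset.mul_sum, mul_eq_zero] at h2
  refine h2.resolve_right (ne_of_gt ?_)
  refine Finset.sum_pos' (fun π _ => by split_ifs <;> positivity) ⟨σ, Finset.mem_univ _, ?_⟩
  rw [if_pos hσ]
  positivity

end NonHook

/-! ### Hook partitions: their symmetrizers, characters and shifted power sums. -/

section HookShape

variable {d : ℕ} {lam : d.Partition}

lemma rowLens_diagram (lam : d.Partition) :
    (diagram lam).rowLens = lam.parts.sort (· ≥ ·) :=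
  YoungDiagram.rowLens_ofRowLens_eq_self fun _ hx => lam.parts_pos ((Multiset.mem_sort _).1 hx)

lemma parts_eq_rowLens (lam : d.Partition) : lam.parts = ↑(diagram lam).rowLens := by
  rw [rowLens_diagram, Multiset.sort_eq]

lemma rowLen_hook (h : (1, 1) ∉ diagram lam) {i : ℕ} (hi : i ≠ 0)
    (hi' : i < (diagram lam).colLen 0) : (diagram lam).rowLen i = 1 := by
  have h1 : 0 < (diagram lam).rowLen i := by
    rwa [← YoungDiagram.mem_iff_lt_rowLen, YoungDiagram.mem_iff_lt_colLen]
  have h2 : ¬ 1 < (diagram lam).rowLen i := by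
    rw [← YoungDiagram.mem_iff_lt_rowLen]
    exact fun h' => h ((diagram lam).up_left_mem (Nat.one_le_iff_ne_zero.2 hi) le_rfl h')
  omega

lemma col_eq_zero_of_row_ne_zero (h : (1, 1) ∉ diagram lam) (T : Tableau lam) {x : Fin d}
    (hx : T.row x ≠ 0) : T.col x = 0 := by
  by_contra hc
  exact h ((diagram lam).up_left_mem (Nat.one_le_iff_ne_zero.2 hx) (Nat.one_le_iff_ne_zero.2 hc)
    (T.symm x).2)

lemma eq_of_row_eq_of_col_eq (T : Tableau lam) {x y : Fin d} (h : T.row x = T.row y)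
    (h' : T.col x = T.col y) : x = y :=
  T.symm.injective (Subtype.ext (Prod.ext h h'))

/-- In a hook every row below the first has a single cell, so preserving rows means moving only the
first row. -/
lemma rowSymmetrizer_hook (h : (1, 1) ∉ diagram lam) (T : Tableau lam) :
    rowSymmetrizer T = twistedSum 1 (Finset.univ.filter fun x => T.row x = 0) := by
  rw [rowSymmetrizer, twistedSum]
  have : (Finset.univ.filter fun p : Perm (Fin d) => ∀ x, T.row (p x) = T.row x) =
      permsOn (Finset.univ.filter fun x => T.row x = 0) := by
    ext p
    rw [Finset.mem_filter]
    constructor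
    · rintro ⟨-, hp⟩
      refine mem_permsOn.2 fun x hx => ?_
      have hx' : T.row x ≠ 0 := by simpa using hx
      refine eq_of_row_eq_of_col_eq T (hp x) ?_
      rw [col_eq_zero_of_row_ne_zero h T hx', col_eq_zero_of_row_ne_zero h T (by rwa [hp x])]
    · intro hp
      refine ⟨Finset.mem_univ _, fun x => ?_⟩
      by_cases hx : x ∈ Finset.univ.filter fun x => T.row x = 0
      · have hx' := (apply_mem_of_mem_permsOn hp).2 hx
        rw [(Finset.mem_filter.1 hx).2, (Finset.mem_filter.1 hx').2]
      · rw [mem_permsOn.1 hp x hx]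
  rw [this]
  simp

lemma colAntisymmetrizer_hook (h : (1, 1) ∉ diagram lam) (T : Tableau lam) :
    colAntisymmetrizer T = twistedSum (signQ d) (Finset.univ.filter fun x => T.col x = 0) := by
  have hrow : ∀ x, T.col x ≠ 0 → T.row x = 0 := fun x hx => by
    by_contra hc
    exact hx (col_eq_zero_of_row_ne_zero h T hc)
  rw [colAntisymmetrizer, twistedSum]
  have : (Finset.univ.filter fun p : Perm (Fin d) => ∀ x, T.col (p x) = T.col x) =
      permsOn (Finset.univ.filter fun x => T.col x = 0) := by
    ext p
    rw [Finset.mem_filter]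
    constructor
    · rintro ⟨-, hp⟩
      refine mem_permsOn.2 fun x hx => ?_
      have hx' : T.col x ≠ 0 := by simpa using hx
      refine eq_of_row_eq_of_col_eq T ?_ (hp x)
      rw [hrow x hx', hrow (p x) (by rwa [hp x])]
    · intro hp
      refine ⟨Finset.mem_univ _, fun x => ?_⟩
      by_cases hx : x ∈ Finset.univ.filter fun x => T.col x = 0
      · have hx' := (apply_mem_of_mem_permsOn hp).2 hx
        rw [(Finset.mem_filter.1 hx).2, (Finset.mem_filter.1 hx').2]
      · rw [mem_permsOn.1 hp x hx]
  rw [this]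
  rfl

lemma zero_mem_diagram (hd : d ≠ 0) (lam : d.Partition) : (0, 0) ∈ diagram lam := by
  have hpos : 0 < (diagram lam).cells.card := by rw [card_diagram]; omega
  obtain ⟨c, hc⟩ := Finset.card_pos.1 hpos
  exact (diagram lam).up_left_mem (Nat.zero_le _) (Nat.zero_le _) hc

/-- The number of boxes of a partition below its first row, if the partition is a hook. -/
def legLength (lam : d.Partition) : ℕ := (diagram lam).colLen 0 - 1

lemma colLen_eq_legLength_add_one (hd : d ≠ 0) (lam : d.Partition) :
    (diagram lam).colLen 0 = legLength lam + 1 := by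
  have := YoungDiagram.mem_iff_lt_colLen.1 (zero_mem_diagram hd lam)
  rw [legLength]
  omega

/-- The Young symmetrizer of a hook. -/
lemma exists_youngSymmetrizer_eq_hookElement (hd : d ≠ 0) (h : (1, 1) ∉ diagram lam)
    (T : Tableau lam) : ∃ (Z : Finset (Fin d)) (o : Fin d), o ∉ Z ∧ Z.card = legLength lam ∧
      (diagram lam).rowLen 0 + Z.card = d ∧ youngSymmetrizer T = hookElement Z o := by
  -- The entry of the corner cell; `Z` will consist of the entries of the leg.
  set o := T ⟨(0, 0), zero_mem_diagram hd lam⟩ with ho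
  have hro : T.row o = 0 := by simp [ho, Tableau.row]
  have hco : T.col o = 0 := by simp [ho, Tableau.col]
  set Z : Finset (Fin d) := Finset.univ.filter fun x => T.row x ≠ 0 with hZ
  have hoZ : o ∉ Z := by simp [hZ, hro]
  have hX : Zᶜ = Finset.univ.filter fun x => T.row x = 0 := by
    ext x
    simp [hZ]
  have hY : insert o Z = Finset.univ.filter fun x => T.col x = 0 := by
    ext x
    simp only [hZ, Finset.mem_insert, Finset.mem_filter, Finset.mem_univ, true_and]
    constructor
    · rintro (rfl | hx)
      · exact hco
      · exact col_eq_zero_of_row_ne_zero h T hx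
    · intro hx
      by_cases hr : T.row x = 0
      · exact Or.inl (eq_of_row_eq_of_col_eq T (hr.trans hro.symm) (hx.trans hco.symm))
      · exact Or.inr hr
  refine ⟨Z, o, hoZ, ?_, ?_, ?_⟩
  · have h1 := card_filter_col T 0
    rw [← hY, Finset.card_insert_of_notMem hoZ] at h1
    rw [legLength]
    omega
  · rw [← card_filter_row T 0, ← hX, Finset.card_compl_add_card, Fintype.card_fin]
  · rw [youngSymmetrizer, rowSymmetrizer_hook h, colAntisymmetrizer_hook h, hookElement, hX, hY]

lemma rowLen_zero_add_legLength (hd : d ≠ 0) (h : (1, 1) ∉ diagram lam) :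
    (diagram lam).rowLen 0 + legLength lam = d := by
  obtain ⟨Z, o, -, h2, h3, -⟩ := exists_youngSymmetrizer_eq_hookElement hd h (someTableau lam)
  rwa [h2] at h3

lemma legLength_lt (hd : d ≠ 0) (h : (1, 1) ∉ diagram lam) : legLength lam < d := by
  have h1 := rowLen_zero_add_legLength hd h
  have h2 := YoungDiagram.mem_iff_lt_rowLen.1 (zero_mem_diagram hd lam)
  omega

theorem irrChar_hook (hd : d ≠ 0) (h : (1, 1) ∉ diagram lam) (σ : Perm (Fin d)) :
    irrChar lam σ = hookChar (legLength lam) σ := by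
  obtain ⟨Z, o, ho, hZ, -, hy⟩ := exists_youngSymmetrizer_eq_hookElement hd h (someTableau lam)
  have hm : ((d : ℚ) * (d - 1 - Z.card)! * Z.card !) ≠ 0 := by
    have : d * (d - 1 - Z.card)! * Z.card ! ≠ 0 :=
      mul_ne_zero (mul_ne_zero hd (Nat.factorial_ne_zero _)) (Nat.factorial_ne_zero _)
    exact_mod_cast this
  rw [irrChar_eq_conjTrace_of_sq hm (by rw [hy, hookElement_sq ho]), hy,
    conjTrace_hookElement σ ho, inv_mul_cancel_left₀ hm, hZ]

lemma legLength_injOn (hd : d ≠ 0) :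
    Set.InjOn (legLength (d := d)) {lam | (1, 1) ∉ diagram lam} := by
  intro lam h mu h' hl
  refine Nat.Partition.ext ?_
  rw [parts_eq_rowLens, parts_eq_rowLens]
  congr 1
  have hc : (diagram lam).colLen 0 = (diagram mu).colLen 0 := by
    rw [colLen_eq_legLength_add_one hd, colLen_eq_legLength_add_one hd, hl]
  rw [YoungDiagram.rowLens, YoungDiagram.rowLens, ← hc]
  refine List.map_congr_left fun i hi => ?_
  rw [List.mem_range] at hi
  by_cases hi0 : i = 0
  · have h1 := rowLen_zero_add_legLength hd h
    have h2 := rowLen_zero_add_legLength hd h'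
    rw [hi0]
    omega
  · rw [rowLen_hook h hi0 hi, rowLen_hook h' hi0 (hc ▸ hi)]

lemma exists_legLength_eq {k : ℕ} (hk : k < d) :
    ∃ lam : d.Partition, (1, 1) ∉ diagram lam ∧ legLength lam = k := by
  let w : List ℕ := (d - k) :: List.replicate k 1
  have hw : w.Pairwise (· ≥ ·) := by
    refine List.pairwise_cons.2 ⟨fun x hx => ?_, ?_⟩
    · rw [List.eq_of_mem_replicate hx]
      omega
    · exact List.pairwise_replicate.2 (Or.inr le_rfl)
  let lam : d.Partition :=
    { parts := w
      parts_pos := by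
        intro i hi
        rcases List.mem_cons.1 (Multiset.mem_coe.1 hi) with rfl | hi
        · omega
        · rw [List.eq_of_mem_replicate hi]
          exact one_pos
      parts_sum := by
        rw [Multiset.sum_coe]
        simp [w]
        omega }
  have hsort : lam.parts.sort (· ≥ ·) = w := by
    change Multiset.sort (↑w) (· ≥ ·) = w
    rw [Multiset.coe_sort]
    exact List.mergeSort_of_pairwise (by simpa using hw)
  have hlen : (diagram lam).colLen 0 = k + 1 := by
    rw [← YoungDiagram.length_rowLens, rowLens_diagram, hsort]
    simp [w]
  refine ⟨lam, ?_, by rw [legLength, hlen]; rfl⟩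
  intro h
  obtain ⟨h1, h2⟩ := YoungDiagram.mem_ofRowLens.1 h
  simp only [hsort] at h1 h2
  simp [w] at h2

/-- Row `i ≥ 1` has length one and contributes `(i + 1/2)^3 - (i - 1/2)^3`, so the sum telescopes.
-/
lemma shiftedPowerSum_hook (hd : d ≠ 0) (h : (1, 1) ∉ diagram lam) :
    shiftedPowerSum 3 lam =
      ((d : ℚ) - legLength lam - 1 / 2) ^ 3 + ((legLength lam : ℚ) + 1 / 2) ^ 3 := by
  have hr : (((diagram lam).rowLen 0 : ℕ) : ℚ) = d - legLength lam := by
    rw [eq_sub_iff_add_eq]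
    exact_mod_cast rowLen_zero_add_legLength hd h
  have hc := colLen_eq_legLength_add_one hd lam
  have key : ∀ k, k ≤ legLength lam → ∑ i ∈ Finset.range (k + 1),
      ((((diagram lam).rowLen i : ℚ) - ((i : ℚ) + 1) + 1 / 2) ^ 3 -
        (-((i : ℚ) + 1) + 1 / 2) ^ 3) =
      ((d : ℚ) - legLength lam - 1 / 2) ^ 3 + ((k : ℚ) + 1 / 2) ^ 3 := by
    intro k hk
    induction k with
    | zero =>
      rw [zero_add, Finset.sum_range_one, hr]
      push_cast
      ring
    | succ k ih =>
      rw [Finset.sum_range_succ, ih (by omega), rowLen_hook h (by omega) (by omega)]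
      push_cast
      ring
  rw [shiftedPowerSum, hc, key _ le_rfl]

/-- A sum over all partitions, weighted by the character values at a long cycle, runs over hooks. -/
theorem sum_irrChar_long_cycle (hd : d ≠ 0) {c : Perm (Fin d)} (hc : c.partition.parts = {d})
    (σ : Perm (Fin d)) (G : ℚ → ℚ) :
    ∑ lam : d.Partition, irrChar lam c * G (shiftedPowerSum 3 lam) * irrChar lam σ =
      ∑ k ∈ Finset.range d,
        (-1) ^ k * G (((d : ℚ) - k - 1 / 2) ^ 3 + ((k : ℚ) + 1 / 2) ^ 3) * hookChar k σ := by
  classical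
  rw [← Finset.sum_filter_add_sum_filter_not Finset.univ
    (fun lam : d.Partition => (1, 1) ∈ diagram lam), Finset.sum_eq_zero, zero_add]
  · refine Finset.sum_nbij legLength ?_ ?_ ?_ ?_
    · intro lam hlam
      exact Finset.mem_range.2 (legLength_lt hd (Finset.mem_filter.1 hlam).2)
    · intro lam h mu h' hl
      exact legLength_injOn hd (Finset.mem_filter.1 h).2 (Finset.mem_filter.1 h').2 hl
    · intro k hk
      obtain ⟨lam, h, hl⟩ := exists_legLength_eq (Finset.mem_range.1 hk)
      exact ⟨lam, by simpa using h, hl⟩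
    · intro lam hlam
      have h := (Finset.mem_filter.1 hlam).2
      rw [irrChar_hook hd h, irrChar_hook hd h, shiftedPowerSum_hook hd h,
        hookChar_of_parts_eq_singleton hc (legLength_lt hd h)]
  · intro lam hlam
    rw [irrChar_long_cycle_eq_zero (Finset.mem_filter.1 hlam).2 hc, zero_mul, zero_mul]

end HookShape

end Characters

/-! ### Moments of the signed measure on hooks. -/

section Moments

open PowerSeries

/-- The power series `exp (a t)`. -/
def expSeries (a : ℚ) : ℚ⟦X⟧ := rescale a (exp ℚ)

lemma coeff_expSeries (a : ℚ) (m : ℕ) : coeff m (expSeries a) = a ^ m / m ! := by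
  simp [expSeries, coeff_rescale, coeff_exp, div_eq_mul_inv]

lemma expSeries_add (a b : ℚ) : expSeries (a + b) = expSeries a * expSeries b :=
  (exp_mul_exp_eq_exp_add a b).symm

lemma expSeries_zero : expSeries 0 = 1 := by simp [expSeries]

lemma expSeries_sum {ι : Type*} (s : Finset ι) (f : ι → ℚ) :
    expSeries (∑ i ∈ s, f i) = ∏ i ∈ s, expSeries (f i) := by
  classical
  induction s using Finset.induction_on with
  | empty => simp [expSeries_zero]
  | insert a s ha ih => rw [Finset.sum_insert ha, Finset.prod_insert ha, expSeries_add, ih]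

lemma expSeries_pow (a : ℚ) (m : ℕ) : expSeries a ^ m = expSeries (m * a) := by
  induction m with
  | zero => simp [expSeries_zero]
  | succ m ih =>
    rw [pow_succ, ih, ← expSeries_add]
    congr 1
    push_cast
    ring

/-- The power series `2 sinh (b t / 2) / t`. -/
def sinhSeries (b : ℚ) : ℚ⟦X⟧ :=
  PowerSeries.mk fun m => ((b / 2) ^ (m + 1) - (-(b / 2)) ^ (m + 1)) / (m + 1)!

/-- The factored form of `exp(bu/2) - exp(-bu/2)` exposes `1 - X^b` at `X = exp(-u)`. -/
lemma X_mul_sinhSeries (b : ℚ) :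
    X * sinhSeries b = expSeries (b / 2) * (1 - expSeries (-b)) := by
  rw [mul_sub, mul_one, ← expSeries_add]
  ext m
  rw [map_sub, coeff_expSeries, coeff_expSeries]
  cases m with
  | zero => simp
  | succ m =>
    rw [coeff_succ_X_mul, sinhSeries, coeff_mk]
    ring

lemma coeff_zero_sinhSeries (b : ℚ) : coeff 0 (sinhSeries b) = b := by
  rw [sinhSeries, coeff_mk]
  norm_num

lemma coeff_one_sinhSeries (b : ℚ) : coeff 1 (sinhSeries b) = 0 := by
  rw [sinhSeries, coeff_mk]
  ring

lemma coeff_two_sinhSeries (b : ℚ) : coeff 2 (sinhSeries b) = b ^ 3 / 24 := by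
  rw [sinhSeries, coeff_mk]
  norm_num [Nat.factorial]
  ring

lemma coeff_prod_sinhSeries {ι : Type*} (s : Finset ι) (b : ι → ℚ) :
    coeff 0 (∏ i ∈ s, sinhSeries (b i)) = ∏ i ∈ s, b i ∧
    coeff 1 (∏ i ∈ s, sinhSeries (b i)) = 0 ∧
    coeff 2 (∏ i ∈ s, sinhSeries (b i)) = (∏ i ∈ s, b i) * (∑ i ∈ s, b i ^ 2) / 24 := by
  classical
  induction s using Finset.induction_on with
  | empty => simp [coeff_one]
  | insert a s ha ih =>
    obtain ⟨h0, h1, h2⟩ := ih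
    rw [Finset.prod_insert ha, Finset.prod_insert ha, Finset.sum_insert ha]
    simp only [coeff_mul, Finset.Nat.antidiagonal_succ, Finset.Nat.antidiagonal_zero,
      Finset.map_singleton, Finset.sum_cons, Finset.sum_singleton, Finset.map_cons,
      Function.Embedding.prodMap, Function.Embedding.coeFn_mk, Prod.map, h0, h1, h2,
      coeff_zero_sinhSeries, Function.Embedding.refl_apply, Nat.succ_eq_add_one, zero_add,
      coeff_one_sinhSeries, coeff_two_sinhSeries, Nat.reduceAdd]
    refine ⟨trivial, by ring, by ring⟩

/-- The first moments of a finite signed measure whose generating function is a product of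
cyclotomic factors. -/
lemma moments_of_generating_function {t d : ℕ} {β : Fin (2 * t + 1) → ℕ} (hd : d = ∑ i, β i)
    {v : ℕ → ℚ}
    (hv : (1 - Polynomial.X) * ∑ k ∈ Finset.range d, Polynomial.C (v k) * Polynomial.X ^ k =
      ∏ i, (1 - (Polynomial.X : Polynomial ℚ) ^ β i)) :
    (∀ m < 2 * t, ∑ k ∈ Finset.range d, v k * (((d : ℚ) - 1) / 2 - k) ^ m = 0) ∧
    ∑ k ∈ Finset.range d, v k * (((d : ℚ) - 1) / 2 - k) ^ (2 * t) = (2 * t)! * ∏ i, (β i : ℚ) ∧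
    ∑ k ∈ Finset.range d, v k * (((d : ℚ) - 1) / 2 - k) ^ (2 * t + 2) =
      (2 * t + 2)! * ((∏ i, (β i : ℚ)) * (∑ i, (β i : ℚ) ^ 2 - 1) / 24) := by
  set F : ℚ⟦X⟧ := ∑ k ∈ Finset.range d, C (v k) * expSeries (((d : ℚ) - 1) / 2 - k) with hF
  have hcoeff : ∀ m, ∑ k ∈ Finset.range d, v k * (((d : ℚ) - 1) / 2 - k) ^ m =
      m ! * coeff m F := by
    intro m
    rw [hF, map_sum, Finset.mul_sum]
    refine Finset.sum_congr rfl fun k _ => ?_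
    have : (m ! : ℚ) ≠ 0 := by exact_mod_cast m.factorial_ne_zero
    rw [coeff_C_mul, coeff_expSeries]
    field_simp
  -- Substitute `X = exp(-u)`; `F` is the exponential generating function of the centred moments.
  have h1 := congrArg (Polynomial.aeval (expSeries (-1))) hv
  simp only [map_mul, map_sub, map_one, Polynomial.aeval_X, map_sum, map_prod, map_pow,
    Polynomial.aeval_C, expSeries_pow, mul_neg, mul_one] at h1
  -- Multiplying by `exp(du/2)` symmetrizes every factor, since `d = ∑ β_i` gives each one its own
  -- `exp(β_i u/2)`, and the remaining `1/2 + (d-1)/2` splits between `1 - X` and `F`.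
  have h2 : X * (sinhSeries 1 * F) = X * (X ^ (2 * t) * ∏ i, sinhSeries (β i)) := by
    have hR : X * (X ^ (2 * t) * ∏ i, sinhSeries (β i)) =
        expSeries ((d : ℚ) / 2) * ∏ i, (1 - expSeries (-(β i : ℚ))) := by
      rw [← mul_assoc, ← pow_succ', show (X : ℚ⟦X⟧) ^ (2 * t + 1) =
        ∏ i : Fin (2 * t + 1), X by simp, ← Finset.prod_mul_distrib]
      simp_rw [X_mul_sinhSeries]
      rw [Finset.prod_mul_distrib, ← expSeries_sum, hd]
      push_cast
      rw [Finset.sum_div]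
    rw [hR, ← h1, ← mul_assoc, X_mul_sinhSeries, hF]
    rw [show (d : ℚ) / 2 = 1 / 2 + ((d : ℚ) - 1) / 2 by ring, expSeries_add]
    simp only [Finset.mul_sum]
    refine Finset.sum_congr rfl fun k _ => ?_
    rw [sub_eq_add_neg _ (k : ℚ), expSeries_add]
    change _ = _ * (_ * (C (v k) * _))
    ring
  have h3 := mul_left_cancel₀ X_ne_zero h2
  set G : ℚ⟦X⟧ := (∏ i, sinhSeries (β i)) * (sinhSeries 1)⁻¹ with hG
  have hS0 : constantCoeff (sinhSeries 1) ≠ 0 := by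
    rw [← coeff_zero_eq_constantCoeff_apply, coeff_zero_sinhSeries]
    exact one_ne_zero
  have hSG : sinhSeries 1 * G = ∏ i, sinhSeries (β i) := by
    rw [hG, mul_left_comm, PowerSeries.mul_inv_cancel _ hS0, mul_one]
  have hFG : F = X ^ (2 * t) * G := by
    have hne : sinhSeries 1 ≠ 0 := fun h => hS0 (by rw [h, map_zero])
    refine mul_left_cancel₀ hne ?_
    rw [h3, ← hSG]
    ring
  obtain ⟨p0, p1, p2⟩ := coeff_prod_sinhSeries Finset.univ (fun i => (β i : ℚ))
  rw [← hSG] at p0 p1 p2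
  simp only [coeff_mul, Finset.Nat.antidiagonal_succ, Finset.Nat.antidiagonal_zero,
      Finset.map_singleton, Finset.sum_cons, Finset.sum_singleton, Finset.map_cons,
      Function.Embedding.prodMap, Function.Embedding.coeFn_mk, Prod.map,
      coeff_zero_sinhSeries, Function.Embedding.refl_apply, Nat.succ_eq_add_one, zero_add,
      coeff_one_sinhSeries, coeff_two_sinhSeries, Nat.reduceAdd] at p0 p1 p2
  refine ⟨fun m hm => ?_, ?_, ?_⟩
  · rw [hcoeff, hFG, coeff_X_pow_mul', if_neg (by omega), mul_zero]
  · rw [hcoeff, hFG, coeff_X_pow_mul', if_pos le_rfl, Nat.sub_self]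
    rw [← p0, one_mul]
  · rw [hcoeff, hFG, coeff_X_pow_mul', if_pos (by omega), Nat.add_sub_cancel_left]
    congr 1
    -- Dividing by `sinhSeries 1 = 1 + u^2/24 + ⋯` produces the `-1` next to `∑ β_i^2`.
    rw [one_mul] at p0
    rw [p0] at p2
    linarith

/-- In the binomial expansion only the terms of degree `2t` and `2t + 2` in `x` have nonvanishing
moments. -/
lemma sum_mul_add_mul_sq_pow {t : ℕ} (s : Finset ℕ) (v x : ℕ → ℚ) (A B : ℚ)
    (h : ∀ m < 2 * t, ∑ k ∈ s, v k * x k ^ m = 0) :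
    ∑ k ∈ s, v k * (A + B * x k ^ 2) ^ (t + 1) =
      (t + 1) * A * B ^ t * ∑ k ∈ s, v k * x k ^ (2 * t) +
        B ^ (t + 1) * ∑ k ∈ s, v k * x k ^ (2 * t + 2) := by
  have h1 : ∀ k ∈ s, v k * (A + B * x k ^ 2) ^ (t + 1) =
      ∑ j ∈ Finset.range (t + 2), (B ^ j * A ^ (t + 1 - j) * (t + 1).choose j) *
        (v k * x k ^ (2 * j)) := by
    intro k _
    rw [add_comm A, add_pow, Finset.mul_sum]
    refine Finset.sum_congr rfl fun j _ => ?_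
    rw [mul_pow, ← pow_mul]
    ring
  rw [Finset.sum_congr rfl h1, Finset.sum_comm]
  simp_rw [← Finset.mul_sum]
  rw [Finset.sum_range_succ, Finset.sum_range_succ, Finset.sum_eq_zero, zero_add]
  · rw [Nat.choose_self, Nat.sub_self, Nat.choose_succ_self_right, Nat.add_sub_cancel_left]
    rw [mul_add_one 2 t]
    push_cast
    ring
  · intro j hj
    rw [h (2 * j) (by have := Finset.mem_range.1 hj; omega), mul_zero]

end Moments

/-! ### Closed formula for the genus one numbers. -/

section Hurwitz

lemma partitionOf_parts {n : ℕ} {β : Fin n → ℕ} (hβ : ∀ i, 0 < β i) :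
    (partitionOf β).parts = Finset.univ.val.map β := by
  change (Finset.univ.val.map β).filter (· ≠ 0) = _
  rw [Multiset.filter_eq_self]
  intro a ha
  obtain ⟨i, -, rfl⟩ := Multiset.mem_map.1 ha
  exact (hβ i).ne'

/-- The genus one, one-part double Hurwitz numbers with completed `3`-cycles. -/
theorem onePartHurwitz_one {t : ℕ} {β : Fin (2 * t + 1) → ℕ} (hβ : ∀ i, 0 < β i) :
    ((∑ i, β i : ℕ) : ℚ) * onePartHurwitz 1 β =
      (t + 1) * (((∑ i, β i : ℕ) : ℚ) ^ 3 / 24) * (((∑ i, β i : ℕ) : ℚ) / 2) ^ t * (2 * t)! +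
      (((∑ i, β i : ℕ) : ℚ) / 2) ^ (t + 1) * ((2 * t + 2)! * ((∑ i, (β i : ℚ) ^ 2 - 1) / 24)) := by
  have hparts := partitionOf_parts hβ
  have hd : (∑ i, β i) ≠ 0 := by
    have : β 0 ≤ ∑ i, β i := Finset.single_le_sum (fun i _ => Nat.zero_le _) (Finset.mem_univ 0)
    have := hβ 0
    omega
  set d := ∑ i, β i with hd_def
  have hind : (Nat.Partition.indiscrete d).parts = {d} := Nat.Partition.indiscrete_parts hd
  have hprod : ((partitionOf β).parts.prod : ℚ) = ∏ i, (β i : ℚ) := by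
    rw [hparts]
    exact_mod_cast rfl
  have hs : numCycles 1 2 (Nat.Partition.indiscrete d) (partitionOf β) = t + 1 := by
    rw [numCycles, hind, hparts]
    simp
    omega
  have hc := (exists_perm (Nat.Partition.indiscrete d)).choose_spec.trans hind
  have hσ := (exists_perm (partitionOf β)).choose_spec.trans hparts
  set σ := (exists_perm (partitionOf β)).choose with hσ_def
  have hgen := one_sub_X_mul_sum_hookChar hd σ
  rw [hσ, Multiset.map_map] at hgen
  obtain ⟨m0, m1, m2⟩ := moments_of_generating_function hd_def hgen
  have hsum := sum_irrChar_long_cycle hd hc σ (fun p => (p / (2 + 1)!) ^ (t + 1))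
  have hG : ∑ k ∈ Finset.range d,
      (-1) ^ k * ((((d : ℚ) - k - 1 / 2) ^ 3 + ((k : ℚ) + 1 / 2) ^ 3) / (2 + 1)!) ^ (t + 1) *
        hookChar k σ =
      ∑ k ∈ Finset.range d, ((-1) ^ k * hookChar k σ) *
        ((d : ℚ) ^ 3 / 24 + d / 2 * (((d : ℚ) - 1) / 2 - k) ^ 2) ^ (t + 1) := by
    refine Finset.sum_congr rfl fun k _ => ?_
    -- With `x = (d-1)/2 - k` the two cubes are `(d/2 + x)^3` and `(d/2 - x)^3`, so odd powers of
    -- `x` cancel.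
    have : (((d : ℚ) - k - 1 / 2) ^ 3 + ((k : ℚ) + 1 / 2) ^ 3) / (2 + 1)! =
        (d : ℚ) ^ 3 / 24 + d / 2 * (((d : ℚ) - 1) / 2 - k) ^ 2 := by
      norm_num [Nat.factorial]
      ring
    rw [this]
    ring
  rw [hG, sum_mul_add_mul_sq_pow _ _ _ _ _ m0, m1, m2] at hsum
  have hd' : (d : ℚ) ≠ 0 := by exact_mod_cast hd
  have hβ' : (∏ i, (β i : ℚ)) ≠ 0 :=
    Finset.prod_ne_zero_iff.2 fun i _ => by exact_mod_cast (hβ i).ne'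
  rw [onePartHurwitz, hurwitz, hs, hprod, hind, Multiset.prod_singleton]
  simp only [chi]
  rw [hsum]
  field_simp

end Hurwitz

/-! ### The Hurwitz polynomial and its top coefficients. -/

section HurwitzPolynomial

open MvPolynomial

lemma IsHurwitzPolynomial.unique {g n : ℕ} {P Q : MvPolynomial (Fin n) ℚ}
    (hP : IsHurwitzPolynomial g P) (hQ : IsHurwitzPolynomial g Q) : P = Q := by
  refine funext_set (fun _ => Set.range fun m : ℕ => ((m + 1 : ℕ) : ℚ)) (fun _ => ?_) fun x hx => ?_
  · refine Set.infinite_range_of_injective fun a b h => ?_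
    exact Nat.succ_injective (Nat.cast_injective h)
  · choose β hβ using fun i => hx i (Set.mem_univ i)
    have hx' : x = fun i => ((β i + 1 : ℕ) : ℚ) := funext fun i => (hβ i).symm
    rw [hx', hP (fun i => β i + 1) fun i => Nat.succ_pos _,
      hQ (fun i => β i + 1) fun i => Nat.succ_pos _]

/-- An explicit form of the genus one Hurwitz polynomial in `2 t + 1` variables. -/
def genusOnePolynomial (t : ℕ) : MvPolynomial (Fin (2 * t + 1)) ℚ :=
  C (((2 * t + 2)! : ℚ) / (24 * 2 ^ (t + 1) * (t + 1)!)) *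
    (C (1 / (2 * t + 1 : ℚ)) * (∑ i, X i) ^ (t + 3) +
      ((∑ i, (∑ j, X j) ^ (t + 1) * X i ^ 2) - (∑ i, X i) ^ (t + 1)))

lemma isHurwitzPolynomial_genusOnePolynomial (t : ℕ) :
    IsHurwitzPolynomial 1 (genusOnePolynomial t) := by
  intro β hβ
  rw [onePartHurwitz_one hβ, show 1 + (2 * t + 1 - 1) / 2 = t + 1 by omega]
  have h1 : ((t + 1)! : ℚ) ≠ 0 := by exact_mod_cast (t + 1).factorial_ne_zero
  have h2 : (2 * t + 1 : ℚ) ≠ 0 := by positivity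
  -- Pulling `(2t + 2)!` out of the term with `(2t)!` is the origin of the factor `1/n = 1/(2t +
  -- 1)`.
  have h3 : ((2 * t + 2)! : ℚ) = (2 * t + 2) * ((2 * t + 1) * (2 * t)!) := by
    rw [Nat.factorial_succ, Nat.factorial_succ]
    push_cast
    ring
  simp only [genusOnePolynomial, map_mul, map_add, map_sub, map_pow, map_sum, eval_C, eval_X,
    ← Finset.mul_sum]
  push_cast
  rw [h3]
  generalize ∑ i, (β i : ℚ) = D
  generalize ∑ i, (β i : ℚ) ^ 2 = E
  rw [div_pow, div_pow]
  field_simp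
  ring

lemma coeff_sum_X_pow {n : ℕ} (b : Fin n → ℕ) (m : ℕ) :
    coeff (Finsupp.equivFunOnFinite.symm b) ((∑ i, X i : MvPolynomial (Fin n) ℚ) ^ m) =
      if ∑ i, b i = m then (Nat.multinomial Finset.univ b : ℚ) else 0 := by
  rw [coeff_sum_X_pow_of_fintype, Finsupp.sum_fintype _ _ fun _ => rfl,
    Finsupp.multinomial_eq_of_support_subset (Finset.subset_univ _)]
  simp

lemma coeff_sum_X_pow_mul_X_sq {n : ℕ} (b : Fin n → ℕ) {m : ℕ} (hb : ∑ i, b i = m + 2)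
    (i : Fin n) :
    coeff (Finsupp.equivFunOnFinite.symm b)
      ((∑ j, X j : MvPolynomial (Fin n) ℚ) ^ m * X i ^ 2) =
      if 2 ≤ b i then (Nat.multinomial Finset.univ (Function.update b i (b i - 2)) : ℚ)
      else 0 := by
  rw [X_pow_eq_monomial, coeff_mul_monomial']
  by_cases h : 2 ≤ b i
  · have hsub : Finsupp.equivFunOnFinite.symm b - Finsupp.single i 2 =
        Finsupp.equivFunOnFinite.symm (Function.update b i (b i - 2)) := by
      ext j
      by_cases hj : j = i
      · subst hj
        simp
      · simp [hj]
    have hsum : ∑ j, Function.update b i (b i - 2) j = m := by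
      rw [Finset.sum_update_of_mem (Finset.mem_univ i), Finset.sdiff_singleton_eq_erase]
      rw [← Finset.add_sum_erase _ _ (Finset.mem_univ i)] at hb
      omega
    rw [if_pos (Finsupp.single_le_iff.2 h), if_pos h, mul_one, hsub, coeff_sum_X_pow, if_pos hsum]
  · rw [if_neg fun h' => h (Finsupp.single_le_iff.1 h'), if_neg h]

theorem coeff_genusOnePolynomial {t : ℕ} {b : Fin (2 * t + 1) → ℕ} (hb : ∑ i, b i = t + 3) :
    (genusOnePolynomial t).coeff (Finsupp.equivFunOnFinite.symm b) =
      ((2 * t + 2)! : ℚ) / (24 * 2 ^ (t + 1) * (t + 1)!) *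
        (1 / (2 * t + 1 : ℚ) * (Nat.multinomial Finset.univ b : ℚ) +
          ∑ i, if 2 ≤ b i then
            (Nat.multinomial Finset.univ (Function.update b i (b i - 2)) : ℚ)
          else 0) := by
  -- The subtracted power has degree `t + 1` and cannot reach a monomial of degree `t + 3`.
  rw [genusOnePolynomial, coeff_C_mul, coeff_add, coeff_sub, coeff_C_mul, coeff_sum_X_pow,
    coeff_sum_X_pow, if_pos hb, if_neg (by omega), sub_zero, coeff_sum]
  simp_rw [coeff_sum_X_pow_mul_X_sq b hb]

end HurwitzPolynomial

end CompletedHurwitz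

end

theorem corollary4p5 (n : ℕ) (hn : Odd n) :
    (∃! P : MvPolynomial (Fin n) ℚ, CompletedHurwitz.IsHurwitzPolynomial 1 P) ∧
    ∀ b : Fin n → ℕ, ∑ i, b i = (n + 5) / 2 →
      CompletedHurwitz.topTerm 1 b =
        ((n + 1)! : ℚ) / (3 * 2 ^ ((n + 7) / 2) * (((n + 1) / 2)! : ℚ)) *
          (1 / (n : ℚ) * (Nat.multinomial Finset.univ b : ℚ) +
            ∑ i, if 2 ≤ b i then
              (Nat.multinomial Finset.univ (Function.update b i (b i - 2)) : ℚ)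
            else 0) := by
  obtain ⟨t, rfl⟩ := hn
  have hP := CompletedHurwitz.isHurwitzPolynomial_genusOnePolynomial t
  refine ⟨⟨_, hP, fun Q hQ => hQ.unique hP⟩, fun b hb => ?_⟩
  -- Existence rules out the default value `0`, and uniqueness identifies the chosen polynomial with
  -- the explicit one.
  have hpoly : CompletedHurwitz.hurwitzPolynomial 1 (2 * t + 1) =
      CompletedHurwitz.genusOnePolynomial t := by
    have hex : ∃ P : MvPolynomial (Fin (2 * t + 1)) ℚ,
        CompletedHurwitz.IsHurwitzPolynomial 1 P := ⟨_, hP⟩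
    rw [CompletedHurwitz.hurwitzPolynomial, dif_pos hex]
    exact hex.choose_spec.unique hP
  have hb' : ∑ i, b i = t + 3 := by omega
  rw [CompletedHurwitz.topTerm, CompletedHurwitz.combHodge, if_pos (by omega), hpoly,
    CompletedHurwitz.coeff_genusOnePolynomial hb', pow_zero, one_mul,
    show (2 * t + 1 + 7) / 2 = t + 1 + 3 by omega, show (2 * t + 1 + 1) / 2 = t + 1 by omega]
  push_cast
  -- The constants agree because `24 = 3 * 2 ^ 3`.
  rw [pow_add _ (t + 1) 3]
  congr 2
  ring
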